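/- Let $n\ge 1$, $G=GL(n,\mathbb R)$, $H=O(n)$, let $\mathrm{Sym}(n,\mathbb R)$ be the space of real symmetric $n\times n$ matrices with Lebesgue measure $dx=\prod_{i\le j}dx_{ij}$, and let $\mathrm{Sym}^+(n,\mathbb R)$ be the open subset of positive definite matrices. Let $\rho(g)S=gS\,{}^tg$ be the representation of $G$ on $V=\mathrm{Sym}(n,\mathbb R)$ and $v_0=I_n$. *The construction.* Let $G$ be a Lie group, $H$ a closed subgroup, $X=G/H$, $V$ a finite-dimensional real representation of $G$ and $v_0\in V$ an $H$-fixed vector. Let $\Omega_0(G,H)$ be the set of continuous homomorphisms $\chi:G\to\mathbb R_{>0}$ with $\chi|_H=1$. For a relatively $G$-invariant measure $\mu$ on $X$ (a nonzero Radon measure such that $\mu(gE)=f(g)\mu(E)$ for some $f:G\to\mathbb R_{>0}$ and all $g\in G$ and Borel sets $E$), put $$d\tilde p_{\varphi,\chi}(x)=e^{-\langle\varphi,\,x\cdot v_0\rangle}\chi(x)\,d\mu(x)\qquad(\varphi\in V^\vee,\ \chi\in\Omega_0(G,H)),$$ let $\Theta$ be the set of pairs $(\varphi,\chi)$ for which $\tilde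 p_{\varphi,\chi}$ is finite, and let $\mathcal P_\mu$ be the set of the normalized measures $p_\theta=\tilde p_\theta(X)^{-1}\tilde p_\theta$, $\theta\in\Theta$. *Claim.* For $G=GL(n,\mathbb R)$, $H=O(n)$, $V=\mathrm{Sym}(n,\mathbb R)$ and $v_0=I_n$ as above: 1. $I_n$ is $H$-fixed, and $gH\mapsto g\,{}^tg$ is a $G$-equivariant homeomorphism $G/H\to\mathrm{Sym}^+(n,\mathbb R)$, by which the two spaces are identified below. 2. $\Omega_0(G,H)=\{\,g\mapsto|\det g|^t \mid t\in\mathbb R\,\}$, distinct $t$ giving distinct characters; and $y\mapsto\mathrm{Tr}(y\,\cdot\,)$ is a bijection $\mathrm{Sym}(n,\mathbb R)\to\mathrm{Sym}(n,\mathbb R)^\vee$. 3. $d\mu_0(x)=(\det x)^{-\frac{n+1}2}dx$ is a (nonzero Radon) $G$-invariant measure on $\mathrm{Sym}^+(n,\mathbb R)$. For $\mu=\mu_0$, $\varphi=\mathrm{Tr}(y\,\cdot\,)$ with $y\in\mathrm{Sym}(n,\mathbb R)$, and $\chi=|\det|^{2\alpha}$ with $\alpha\in\mathbb R$, the measure $\tilde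 p_{\varphi,\chi}$ is $e^{-\mathrm{Tr}(yx)}(\det x)^{\alpha}\,d\mu_0(x)$, and $(\varphi,\chi)\in\Theta$ if and only if $y$ is positive definite and $\alpha>\frac{n-1}2$. In that case $$\int_{\mathrm{Sym}^+(n,\mathbb R)}e^{-\mathrm{Tr}(yx)}(\det x)^{\alpha}\frac{dx}{(\det x)^{\frac{n+1}2}}=\pi^{\frac{n(n-1)}4}\prod_{k=1}^n\Gamma\!\left(\alpha-\tfrac{k-1}2\right)(\det y)^{-\alpha},$$ and $p_{\varphi,\chi}$ is the Wishart distribution $$\frac{(\det y)^{\alpha}}{\pi^{\frac{n(n-1)}4}\prod_{k=1}^n\Gamma\left(\alpha-\frac{k-1}2\right)}\,e^{-\mathrm{Tr}(yx)}(\det x)^{\alpha-\frac{n+1}2}\,dx ,$$ which is a probability measure. 4. For every relatively $G$-invariant measure $\mu$ on $G/H$, the family $\mathcal P_\mu$ is exactly the set of these Wishart distributions, $y\in\mathrm{Sym}^+(n,\mathbb R)$, $\alpha>\frac{n-1}2$. -/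

import Mathlib

open MeasureTheory
open scoped ENNReal

noncomputable section

/-! ### Characters trivial on a subgroup -/

/-- `Ω₀(G, H)`: the continuous homomorphisms from `G` to the multiplicative group of positive
reals that are trivial on `H`. -/
def Omega0 (G : Type*) [Group G] [TopologicalSpace G] (H : Subgroup G) : Set (G →* ℝ) :=
  {χ | Continuous χ ∧ (∀ g, 0 < χ g) ∧ ∀ h ∈ H, χ h = 1}

/-! ### The general construction of a family of distributions on `G / H` -/

/-- The data from which a family is built: a closed subgroup `H` of `G`, a continuous
finite-dimensional real representation `ρ` of `G` on `V`, and an `H`-fixed vector `v₀`.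
Of the Lie group `G` the construction uses only the topological group. -/
structure MethodInput (G V : Type*) [Group G] [TopologicalSpace G] [IsTopologicalGroup G]
    [AddCommGroup V] [Module ℝ V] [FiniteDimensional ℝ V]
    [TopologicalSpace V] [IsTopologicalAddGroup V] [ContinuousSMul ℝ V] [T2Space V] where
  /-- the closed subgroup -/
  H : Subgroup G
  isClosed_H : IsClosed (H : Set G)
  /-- the representation -/
  ρ : Representation ℝ G V
  continuous_ρ : Continuous fun p : G × V => ρ p.1 p.2
  /-- the fixed vector -/
  v₀ : V
  fixed : ∀ h ∈ H, ρ h v₀ = v₀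

namespace MethodInput

variable {G V : Type*} [Group G] [TopologicalSpace G] [IsTopologicalGroup G]
  [AddCommGroup V] [Module ℝ V] [FiniteDimensional ℝ V]
  [TopologicalSpace V] [IsTopologicalAddGroup V] [ContinuousSMul ℝ V] [T2Space V]

/-- The sample space `X = G / H`, with the quotient topology, its Borel sets and the action of
`G` by left translation. -/
def X (I : MethodInput G V) : Type _ := G ⧸ I.H

instance (I : MethodInput G V) : TopologicalSpace I.X :=
  inferInstanceAs (TopologicalSpace (G ⧸ I.H))

instance (I : MethodInput G V) : MulAction G I.X :=
  inferInstanceAs (MulAction G (G ⧸ I.H))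

instance (I : MethodInput G V) : MeasurableSpace I.X := borel _

instance (I : MethodInput G V) : BorelSpace I.X := ⟨rfl⟩

/-- `x ↦ x · v₀`, that is `g H ↦ ρ(g) v₀`. -/
def orbit (I : MethodInput G V) : I.X → V :=
  Quotient.lift (fun g : G => I.ρ g I.v₀) (by
    intro a b hab
    have h : a⁻¹ * b ∈ I.H := QuotientGroup.leftRel_apply.mp hab
    have h2 := congrArg (I.ρ a) (I.fixed _ h)
    rw [← Module.End.mul_apply, ← map_mul, mul_inv_cancel_left] at h2
    exact h2.symm)

/-- `x ↦ χ(x)`, that is `g H ↦ χ(g)`, for `χ ∈ Ω₀(G, H)`. -/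
def charFun (I : MethodInput G V) (χ : Omega0 G I.H) : I.X → ℝ :=
  Quotient.lift (fun g : G => χ.1 g) (by
    intro a b hab
    have h : a⁻¹ * b ∈ I.H := QuotientGroup.leftRel_apply.mp hab
    have h2 := χ.2.2.2 _ h
    have h3 : χ.1 b = χ.1 a * χ.1 (a⁻¹ * b) := by rw [← map_mul, mul_inv_cancel_left]
    rw [h3, h2, mul_one])

/-- `μ` is a nonzero Radon measure on `X` with `μ (g E) = f g * μ E` for all `g` and all Borel
sets `E`. -/
structure IsRelInvariantWith (I : MethodInput G V) (μ : Measure I.X) (f : G → ℝ) : Prop where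
  regular : μ.Regular
  ne_zero : μ ≠ 0
  pos : ∀ g, 0 < f g
  smul : ∀ (g : G) (E : Set I.X), MeasurableSet E →
    μ ((fun x => g • x) '' E) = ENNReal.ofReal (f g) * μ E

/-- `μ` is a relatively `G`-invariant measure on `X`. -/
def IsRelInvariant (I : MethodInput G V) (μ : Measure I.X) : Prop :=
  ∃ f : G → ℝ, I.IsRelInvariantWith μ f

/-- The measure `exp(-⟨φ, x · v₀⟩) χ(x) dμ(x)` for `θ = (φ, χ)`. -/
def unnormalized (I : MethodInput G V) (μ : Measure I.X)
    (θ : Module.Dual ℝ V × Omega0 G I.H) : Measure I.X :=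
  μ.withDensity fun x => ENNReal.ofReal (Real.exp (-(θ.1 (I.orbit x))) * I.charFun θ.2 x)

/-- The parameter space `Θ`: the `θ` for which `unnormalized μ θ` is finite. -/
def Theta (I : MethodInput G V) (μ : Measure I.X) : Set (Module.Dual ℝ V × Omega0 G I.H) :=
  {θ | I.unnormalized μ θ Set.univ < ∞}

/-- The normalized measure `c_θ exp(-⟨φ, x · v₀⟩) χ(x) dμ(x)`. -/
def normalized (I : MethodInput G V) (μ : Measure I.X)
    (θ : Module.Dual ℝ V × Omega0 G I.H) : Measure I.X :=
  (I.unnormalized μ θ Set.univ)⁻¹ • I.unnormalized μ θ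

/-- The family of distributions on `X` produced by the construction. -/
def family (I : MethodInput G V) (μ : Measure I.X) : Set (Measure I.X) :=
  I.normalized μ '' I.Theta μ

end MethodInput

/-! ### Symmetric matrices -/

/-- The space `Sym(n, ℝ)`. -/
def SymMat (n : ℕ) : Submodule ℝ (Matrix (Fin n) (Fin n) ℝ) where
  carrier := {S | S.IsSymm}
  add_mem' := fun ha hb => ha.add hb
  zero_mem' := Matrix.isSymm_zero
  smul_mem' := fun c _ h => h.smul c

/-- The Borel sets of `Sym(n, ℝ)`. -/
instance (n : ℕ) : MeasurableSpace (SymMat n) := borel _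

instance (n : ℕ) : BorelSpace (SymMat n) := ⟨rfl⟩

/-- The identity matrix as an element of `Sym(n, ℝ)`. -/
def symOne (n : ℕ) : SymMat n := ⟨1, Matrix.isSymm_one⟩

/-- The set `Sym⁺(n, ℝ)` of positive definite symmetric matrices. -/
abbrev SymPos (n : ℕ) : Type := {S : SymMat n // S.1.PosDef}

/-- The symmetric matrix with given entries on and above the diagonal. -/
def symOfUpper (n : ℕ) (c : {p : Fin n × Fin n // p.1 ≤ p.2} → ℝ) : SymMat n :=
  ⟨Matrix.of fun i j => c ⟨(min i j, max i j), min_le_max⟩, by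
    ext i j
    simp [Matrix.transpose_apply, min_comm, max_comm]⟩

/-- The Lebesgue measure `dx = ∏_{i ≤ j} dx_{ij}` on `Sym(n, ℝ)`. -/
def symVolume (n : ℕ) : Measure (SymMat n) := Measure.map (symOfUpper n) volume

/-- The Lebesgue measure `dx` on `Sym⁺(n, ℝ)`. -/
def posVolume (n : ℕ) : Measure (SymPos n) := Measure.comap Subtype.val (symVolume n)

/-- The measure `dx / (det x)^((n+1)/2)` on `Sym⁺(n, ℝ)`. -/
def posInvariant (n : ℕ) : Measure (SymPos n) :=
  (posVolume n).withDensity fun x => ENNReal.ofReal (x.1.1.det ^ (-(((n : ℝ) + 1) / 2)))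

/-- The linear form `x ↦ Tr(y x)` on `Sym(n, ℝ)`. -/
def traceDual (n : ℕ) (y : SymMat n) : Module.Dual ℝ (SymMat n) where
  toFun x := (y.1 * x.1).trace
  map_add' a b := by simp [mul_add]
  map_smul' c a := by simp

/-- `π^(n(n-1)/4) ∏_{k=1}^n Γ(α - (k-1)/2)`. -/
def wishartGamma (n : ℕ) (α : ℝ) : ℝ :=
  Real.pi ^ ((n : ℝ) * ((n : ℝ) - 1) / 4) *
    ∏ k ∈ Finset.Icc 1 n, Real.Gamma (α - ((k : ℝ) - 1) / 2)

/-- The Wishart distribution with parameters `y` and `α` on `Sym⁺(n, ℝ)`: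
`(det y)^α / (π^(n(n-1)/4) ∏_k Γ(α - (k-1)/2)) exp(-Tr(y x)) (det x)^(α - (n+1)/2) dx`. -/
def wishart (n : ℕ) (y : SymPos n) (α : ℝ) : Measure (SymPos n) :=
  (posVolume n).withDensity fun x => ENNReal.ofReal
    (y.1.1.det ^ α / wishartGamma n α * Real.exp (-(y.1.1 * x.1.1).trace) *
      x.1.1.det ^ (α - ((n : ℝ) + 1) / 2))

/-! ### The data `GL(n, ℝ)`, `O(n)`, `S ↦ g S gᵗ`, `I_n` -/

/-- `O(n)` as a subgroup of `GL(n, ℝ)`. -/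
def orthGroup (n : ℕ) : Subgroup (GL (Fin n) ℝ) where
  carrier := {g | g.1 ∈ Matrix.orthogonalGroup (Fin n) ℝ}
  mul_mem' := fun {a b} ha hb =>
    (Matrix.orthogonalGroup (Fin n) ℝ).mul_mem (x := a.1) (y := b.1) ha hb
  one_mem' := (Matrix.orthogonalGroup (Fin n) ℝ).one_mem
  inv_mem' := by
    intro g hg
    have h : (g⁻¹).1 = star g.1 :=
      Units.inv_eq_of_mul_eq_one_right (Matrix.mem_orthogonalGroup_iff (Fin n) ℝ |>.mp hg)
    change (g⁻¹).1 ∈ Matrix.orthogonalGroup (Fin n) ℝ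
    rw [h]
    exact Unitary.star_mem hg

theorem mem_orthGroup {n : ℕ} {g : GL (Fin n) ℝ} :
    g ∈ orthGroup n ↔ g.1 * g.1.transpose = 1 :=
  Matrix.mem_orthogonalGroup_iff (Fin n) ℝ (A := g.1)

/-- The representation `ρ(g) S = g S gᵗ` of `GL(n, ℝ)` on `Sym(n, ℝ)`. -/
def congrRep (n : ℕ) : Representation ℝ (GL (Fin n) ℝ) (SymMat n) where
  toFun g :=
    { toFun := fun S => ⟨g.1 * S.1 * g.1.transpose, by
        have h : S.1.transpose = S.1 := S.2
        change (g.1 * S.1 * g.1.transpose).transpose = _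
        simp [Matrix.transpose_mul, h, mul_assoc]⟩
      map_add' := fun a b => by ext1; simp [mul_add, add_mul]
      map_smul' := fun c a => by ext1; simp }
  map_one' := by ext1 S; ext1; simp
  map_mul' := fun a b => by ext1 S; ext1; simp [Matrix.transpose_mul, mul_assoc]

theorem congrRep_symOne (n : ℕ) : ∀ h ∈ orthGroup n, congrRep n h (symOne n) = symOne n := by
  intro h hh
  have h1 : h.1 * h.1.transpose = 1 := mem_orthGroup.mp hh
  ext1
  simpa [congrRep, symOne] using h1

theorem isClosed_orthGroup (n : ℕ) : IsClosed (orthGroup n : Set (GL (Fin n) ℝ)) := by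
  have h : (orthGroup n : Set (GL (Fin n) ℝ)) = {g | g.1 * g.1.transpose = 1} := by
    ext g
    exact mem_orthGroup
  rw [h]
  exact isClosed_eq
    (Units.continuous_val.mul Units.continuous_val.matrix_transpose) continuous_const

theorem continuous_congrRep (n : ℕ) :
    Continuous fun p : GL (Fin n) ℝ × SymMat n => congrRep n p.1 p.2 := by
  refine Continuous.subtype_mk ?_ _
  have h1 : Continuous fun p : GL (Fin n) ℝ × SymMat n => p.1.1 :=
    Units.continuous_val.comp continuous_fst
  exact (h1.mul (continuous_subtype_val.comp continuous_snd)).mul h1.matrix_transpose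

/-- The data `G = GL(n, ℝ)`, `H = O(n)`, `V = Sym(n, ℝ)`, `ρ(g) S = g S gᵗ`, `v₀ = I_n`. -/
def wishartInput (n : ℕ) : MethodInput (GL (Fin n) ℝ) (SymMat n) where
  H := orthGroup n
  isClosed_H := isClosed_orthGroup n
  ρ := congrRep n
  continuous_ρ := continuous_congrRep n
  v₀ := symOne n
  fixed := congrRep_symOne n

theorem posDef_orbit (n : ℕ) (x : (wishartInput n).X) :
    ((wishartInput n).orbit x).1.PosDef := by
  obtain ⟨g, rfl⟩ := Quotient.exists_rep x
  change (g.1 * 1 * g.1.transpose).PosDef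
  rw [mul_one, ← Matrix.conjTranspose_eq_transpose_of_trivial]
  refine Matrix.PosDef.mul_conjTranspose_self _ ?_
  exact Matrix.vecMul_injective_of_isUnit g.isUnit

/-- The map `GL(n, ℝ) / O(n) → Sym⁺(n, ℝ)`, `g O(n) ↦ g I_n gᵗ`. -/
def toSymPos (n : ℕ) (x : (wishartInput n).X) : SymPos n :=
  ⟨(wishartInput n).orbit x, posDef_orbit n x⟩

/-- The measure on `GL(n, ℝ) / O(n)` corresponding to `dx / (det x)^((n+1)/2)`. -/
def quotInvariant (n : ℕ) : Measure (wishartInput n).X :=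
  Measure.comap (toSymPos n) (posInvariant n)

/-- The element `g ↦ |det g|^t` of `Ω₀(GL(n, ℝ), O(n))`. -/
def detChar (n : ℕ) (t : ℝ) : Omega0 (GL (Fin n) ℝ) (wishartInput n).H :=
  ⟨{ toFun := fun g => |g.1.det| ^ t
     map_one' := by simp
     map_mul' := fun a b => by
      simp [Matrix.det_mul, abs_mul, Real.mul_rpow (abs_nonneg _) (abs_nonneg _)] }, by
    have hpos : ∀ g : GL (Fin n) ℝ, 0 < |g.1.det| := fun g =>
      abs_pos.mpr ((Matrix.isUnit_iff_isUnit_det _).mp g.isUnit).ne_zero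
    refine ⟨?_, fun g => Real.rpow_pos_of_pos (hpos g) t, ?_⟩
    · exact Continuous.rpow_const (Units.continuous_val.matrix_det.abs)
        fun g => Or.inl (hpos g).ne'
    · intro h hh
      have h1 : h.1 * h.1.transpose = 1 := mem_orthGroup.mp hh
      have h2 : h.1.det * h.1.det = 1 := by
        have := congrArg Matrix.det h1
        simpa [Matrix.det_mul, Matrix.det_transpose] using this
      have h3 : |h.1.det| = 1 := by
        have h4 : |h.1.det| * |h.1.det| = 1 := by rw [← abs_mul, h2, abs_one]
        nlinarith [abs_nonneg h.1.det]
      change |h.1.det| ^ t = 1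
      rw [h3, Real.one_rpow]⟩

end

/-! Homogeneous space. The spectral theorem writes a positive definite `S` as `g gᵗ` with `g = u
√d`, so `GL(n, ℝ)` acts transitively on the cone, and the stabilizer of `I_n` is `O(n)`. The open
mapping theorem for σ-compact groups makes the bijection a homeomorphism (`isHomeomorph_toSymPos`).

Characters. A positive character kills transvections, each being conjugate to its own square, and is
invariant under permuting diagonal entries. It is therefore determined by one character of `ℝˣ`, and
measurability makes that a power of `|·|` (`exists_eq_abs_det_rpow`). The lemma is used three times:
for `Ω₀`, for the Jacobian of `S ↦ g S gᵗ`, and for the multiplier of a relatively invariant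
measure.

The integral. An orthogonal change of variables makes `y` diagonal. Splitting off the first row `(a,
b)` and translating the remaining block by `a⁻¹ b bᵗ` factors the integrand into a Gamma integrand
in `a`, Gaussians in `b`, and the same density of size one less with exponent lowered by `1/2`
(`diagLIntegral_succ`). Everything is computed in `[0, ∞]`, without assumptions on the parameters.
As no factor vanishes, a finite product has finite Gamma factors at every stage; this recursion
yields both the exact parameter domain and the constant.

All relatively invariant measures. Fubini on the group times the space shows that a multiplier
determines the measure up to a scalar (`exists_eq_smul_of_relInvariant`). Multipliers are powers of
`|det|`, so each such measure is `k (det x)^r` times the invariant one. Normalization cancels `k`,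
and `r` only shifts `α`, so the family is unchanged (`map_family_eq`). -/

noncomputable section

/-! ### Topology of the general linear group -/

section GeneralLinearTopology

attribute [local instance] Matrix.linftyOpNormedRing Matrix.linftyOpNormedAlgebra

/-- Units are open in a complete normed ring; the operator norm is introduced locally for this
alone. -/
theorem isOpenEmbedding_generalLinear_val (n : ℕ) :
    Topology.IsOpenEmbedding (Units.val : GL (Fin n) ℝ → Matrix (Fin n) (Fin n) ℝ) := by
  have : CompleteSpace (Matrix (Fin n) (Fin n) ℝ) :=
    inferInstanceAs (CompleteSpace (Fin n → Fin n → ℝ))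
  exact Units.isOpenEmbedding_val

end GeneralLinearTopology

instance (n : ℕ) : SecondCountableTopology (Matrix (Fin n) (Fin n) ℝ) :=
  inferInstanceAs (SecondCountableTopology (Fin n → Fin n → ℝ))

instance (n : ℕ) : LocallyCompactSpace (Matrix (Fin n) (Fin n) ℝ) :=
  inferInstanceAs (LocallyCompactSpace (Fin n → Fin n → ℝ))

instance (n : ℕ) : SecondCountableTopology (GL (Fin n) ℝ) :=
  (isOpenEmbedding_generalLinear_val n).isEmbedding.secondCountableTopology

instance (n : ℕ) : LocallyCompactSpace (GL (Fin n) ℝ) :=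
  (isOpenEmbedding_generalLinear_val n).locallyCompactSpace

instance (n : ℕ) : MeasurableSpace (GL (Fin n) ℝ) := borel _

instance (n : ℕ) : BorelSpace (GL (Fin n) ℝ) := ⟨rfl⟩

/-! ### The positive definite cone as a homogeneous space, and trace duality -/

theorem isClosed_symMat (n : ℕ) : IsClosed (SymMat n : Set (Matrix (Fin n) (Fin n) ℝ)) :=
  isClosed_eq continuous_id.matrix_transpose continuous_id

instance (n : ℕ) : LocallyCompactSpace (SymMat n) :=
  (isClosed_symMat n).isClosedEmbedding_subtypeVal.locallyCompactSpace

instance (n : ℕ) : SecondCountableTopology (SymMat n) :=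
  TopologicalSpace.Subtype.secondCountableTopology (SymMat n : Set (Matrix (Fin n) (Fin n) ℝ))

theorem symMat_posDef_iff {n : ℕ} (S : SymMat n) :
    S.1.PosDef ↔ ∀ v : Fin n → ℝ, v ≠ 0 → 0 < v ⬝ᵥ (S.1.mulVec v) := by
  rw [Matrix.posDef_iff_dotProduct_mulVec]
  have h : S.1.IsHermitian := by
    rw [Matrix.IsHermitian, Matrix.conjTranspose_eq_transpose_of_trivial]; exact S.2
  simp only [h, true_and, star_trivial, ne_eq]

/-- The complement is the projection, along the compact unit sphere, of the closed set of pairs `(S,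
v)` with `vᵗ S v ≤ 0`. -/
theorem isOpen_posDef (n : ℕ) : IsOpen {S : SymMat n | S.1.PosDef} := by
  have hK : CompactSpace (Metric.sphere (0 : Fin n → ℝ) 1) :=
    isCompact_iff_compactSpace.mp (isCompact_sphere _ _)
  have hC : IsClosed {p : SymMat n × Metric.sphere (0 : Fin n → ℝ) 1 |
      p.2.1 ⬝ᵥ (p.1.1.mulVec p.2.1) ≤ 0} := by
    refine isClosed_le ?_ continuous_const
    have h1 : Continuous fun p : SymMat n × Metric.sphere (0 : Fin n → ℝ) 1 => p.2.1 := by fun_prop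
    have h2 : Continuous fun p : SymMat n × Metric.sphere (0 : Fin n → ℝ) 1 => p.1.1 := by fun_prop
    exact h1.dotProduct (h2.matrix_mulVec h1)
  rw [← isClosed_compl_iff]
  convert isClosedMap_fst_of_compactSpace _ hC using 1
  ext S
  simp only [Set.mem_compl_iff, Set.mem_ofPred_eq, symMat_posDef_iff S, Set.mem_image, Prod.exists,
    exists_and_right, exists_eq_right]
  push Not
  constructor
  · rintro ⟨v, hv, h⟩
    have hv' : 0 < ‖v‖ := norm_pos_iff.mpr hv
    refine ⟨⟨‖v‖⁻¹ • v, by simp [norm_smul, hv'.ne']⟩, ?_⟩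
    simp only [Matrix.mulVec_smul, dotProduct_smul, smul_dotProduct, smul_eq_mul]
    have := mul_nonneg (inv_nonneg.mpr hv'.le) (inv_nonneg.mpr hv'.le)
    nlinarith
  · rintro ⟨⟨v, hv⟩, h⟩
    refine ⟨v, ?_, h⟩
    rintro rfl
    simp at hv

instance (n : ℕ) : LocallyCompactSpace (SymPos n) :=
  (isOpen_posDef n).isOpenEmbedding_subtypeVal.locallyCompactSpace

instance (n : ℕ) : MulAction (GL (Fin n) ℝ) (SymPos n) where
  smul g S := ⟨congrRep n g S.1, by
    have h := (Matrix.IsUnit.posDef_star_right_conjugate_iff (x := S.1.1) g.isUnit).mpr S.2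
    rwa [Matrix.star_eq_conjTranspose, Matrix.conjTranspose_eq_transpose_of_trivial] at h⟩
  one_smul S := by
    apply Subtype.ext
    change congrRep n 1 S.1 = S.1
    simp
  mul_smul g h S := by
    apply Subtype.ext
    change congrRep n (g * h) S.1 = congrRep n g (congrRep n h S.1)
    simp

theorem SymPos.coe_smul {n : ℕ} (g : GL (Fin n) ℝ) (S : SymPos n) :
    (g • S).1 = congrRep n g S.1 := rfl

theorem congrRep_coe {n : ℕ} (g : GL (Fin n) ℝ) (S : SymMat n) :
    (congrRep n g S).1 = g.1 * S.1 * g.1.transpose := rfl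

instance (n : ℕ) : ContinuousSMul (GL (Fin n) ℝ) (SymPos n) where
  continuous_smul := ((continuous_congrRep n).comp
    (continuous_fst.prodMk (continuous_subtype_val.comp continuous_snd))).subtype_mk _

/-- The identity matrix as a positive definite matrix. -/
def posOne (n : ℕ) : SymPos n := ⟨symOne n, Matrix.PosDef.one⟩

/-- A symmetric matrix is orthogonally diagonalizable. -/
theorem symMat_exists_orthogonal_diagonal {n : ℕ} (S : SymMat n) :
    ∃ u ∈ orthGroup n, ∃ d : Fin n → ℝ, S.1 = u.1 * Matrix.diagonal d * u.1.transpose := by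
  have h : S.1.IsHermitian := by
    rw [Matrix.IsHermitian, Matrix.conjTranspose_eq_transpose_of_trivial]; exact S.2
  refine ⟨Unitary.toUnits h.eigenvectorUnitary, h.eigenvectorUnitary.2, h.eigenvalues, ?_⟩
  have := h.spectral_theorem
  simpa [Unitary.conjStarAlgAut_apply, Matrix.star_eq_conjTranspose,
    Matrix.conjTranspose_eq_transpose_of_trivial, Function.comp_def] using this

theorem det_ne_zero {n : ℕ} (g : GL (Fin n) ℝ) : g.1.det ≠ 0 :=
  ((Matrix.isUnit_iff_isUnit_det _).mp g.isUnit).ne_zero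

theorem SymPos.exists_smul_posOne {n : ℕ} (S : SymPos n) :
    ∃ g : GL (Fin n) ℝ, g • posOne n = S := by
  obtain ⟨u, hu, d, hd⟩ := symMat_exists_orthogonal_diagonal S.1
  have hpos : ∀ i, 0 < d i := by
    have h := S.2
    rw [hd, ← Matrix.conjTranspose_eq_transpose_of_trivial, ← Matrix.star_eq_conjTranspose,
      Matrix.IsUnit.posDef_star_right_conjugate_iff u.isUnit] at h
    exact Matrix.posDef_diagonal_iff.mp h
  let r := Matrix.diagonal fun i => √(d i)
  have hr : r.det ≠ 0 := by
    rw [Matrix.det_diagonal]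
    exact Finset.prod_ne_zero_iff.mpr fun i _ => (Real.sqrt_pos.mpr (hpos i)).ne'
  refine ⟨u * Matrix.GeneralLinearGroup.mkOfDetNeZero r hr, ?_⟩
  apply Subtype.ext
  apply Subtype.ext
  rw [SymPos.coe_smul, congrRep_coe, hd]
  have h2 : r * r.transpose = Matrix.diagonal d := by
    simp [r, Matrix.diagonal_mul_diagonal, Real.mul_self_sqrt (hpos _).le]
  change u.1 * r * 1 * (u.1 * r).transpose = _
  rw [Matrix.transpose_mul, mul_one, ← h2]
  simp only [mul_assoc]

instance (n : ℕ) : MulAction.IsPretransitive (GL (Fin n) ℝ) (SymPos n) where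
  exists_smul_eq x y := by
    obtain ⟨g, rfl⟩ := x.exists_smul_posOne
    obtain ⟨h, rfl⟩ := y.exists_smul_posOne
    exact ⟨h * g⁻¹, by simp [mul_smul]⟩

theorem toSymPos_mk (n : ℕ) (g : GL (Fin n) ℝ) :
    toSymPos n (Quotient.mk _ g) = g • posOne n := rfl

theorem toSymPos_smul (n : ℕ) (g : GL (Fin n) ℝ) (x : (wishartInput n).X) :
    toSymPos n (g • x) = g • toSymPos n x := by
  obtain ⟨k, rfl⟩ := Quotient.exists_rep x
  exact mul_smul g k (posOne n)

/-- The stabilizer of `I_n` is exactly `O(n)`. -/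
theorem toSymPos_injective (n : ℕ) : Function.Injective (toSymPos n) := by
  intro x y hxy
  obtain ⟨a, rfl⟩ := Quotient.exists_rep x
  obtain ⟨b, rfl⟩ := Quotient.exists_rep y
  rw [toSymPos_mk, toSymPos_mk] at hxy
  refine Quotient.sound (QuotientGroup.leftRel_apply.mpr ?_)
  have h : (a⁻¹ * b) • posOne n = posOne n := by rw [mul_smul, ← hxy, inv_smul_smul]
  change a⁻¹ * b ∈ orthGroup n
  rw [mem_orthGroup]
  have := congrArg (fun S : SymPos n => S.1.1) h
  simpa [SymPos.coe_smul, congrRep_coe, posOne, symOne, mul_assoc] using this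

theorem isHomeomorph_toSymPos (n : ℕ) : IsHomeomorph (toSymPos n) := by
  refine ⟨?_, ?_, toSymPos_injective n, fun S => ?_⟩
  · refine continuous_quot_lift _ ?_ |>.subtype_mk _
    exact (continuous_congrRep n).comp (continuous_id.prodMk continuous_const)
  · intro U hU
    -- Open mapping theorem for a transitive action of a σ-compact group; the cone is locally
    -- compact, hence Baire.
    have h := isOpenMap_smul_of_sigmaCompact (G := GL (Fin n) ℝ) (posOne n) _
      (hU.preimage (continuous_quotient_mk' :
        Continuous (Quotient.mk (QuotientGroup.leftRel (orthGroup n)))))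
    convert h using 1
    ext S
    constructor
    · rintro ⟨x, hx, rfl⟩
      obtain ⟨k, rfl⟩ := Quotient.exists_rep x
      exact ⟨k, hx, rfl⟩
    · rintro ⟨k, hk, rfl⟩
      exact ⟨_, hk, rfl⟩
  · obtain ⟨g, rfl⟩ := S.exists_smul_posOne
    exact ⟨Quotient.mk _ g, rfl⟩

/-- The linear map `y ↦ Tr(y ·)`. -/
def traceDualLinear (n : ℕ) : SymMat n →ₗ[ℝ] Module.Dual ℝ (SymMat n) where
  toFun := traceDual n
  map_add' a b := by ext x; simp [traceDual, add_mul]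
  map_smul' c a := by ext x; simp [traceDual]

/-- `Tr(y y)` is the sum of the squares of the entries of `y`, so the kernel is zero; dimensions
agree. -/
theorem bijective_traceDual (n : ℕ) : Function.Bijective (traceDual n) := by
  have hinj : Function.Injective (traceDualLinear n) := by
    rw [injective_iff_map_eq_zero]
    intro y hy
    have h : (y.1 * y.1).trace = 0 := congrArg (fun f => f y) hy
    have h2 : y.1.conjTranspose = y.1 := by
      rw [Matrix.conjTranspose_eq_transpose_of_trivial]; exact y.2
    nth_rewrite 1 [← h2] at h
    exact Subtype.ext (Matrix.trace_conjTranspose_mul_self_eq_zero_iff.mp h)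
  exact ⟨hinj, (LinearMap.injective_iff_surjective_of_finrank_eq_finrank
    Subspace.dual_finrank_eq.symm).mp hinj⟩

/-! ### Positive characters of `GL(n, ℝ)` -/

section Characters

variable {n : ℕ}

/-- Conjugation by the diagonal matrix with `2` in place `i` doubles the coefficient, that is,
squares the transvection; hence `χ g = (χ g)²`. -/
theorem character_transvection (χ : GL (Fin n) ℝ →* ℝ) (hpos : ∀ g, 0 < χ g)
    (t : Matrix.TransvectionStruct (Fin n) ℝ) (g : GL (Fin n) ℝ) (hg : g.1 = t.toMatrix) :
    χ g = 1 := by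
  obtain ⟨i, j, hij, c⟩ := t
  let D : GL (Fin n) ℝ := Matrix.GeneralLinearGroup.mkOfDetNeZero
    (Matrix.diagonal (Function.update 1 i 2)) (by
      rw [Matrix.det_diagonal]
      refine Finset.prod_ne_zero_iff.mpr fun k _ => ?_
      by_cases h : k = i <;> simp [h])
  have hD : D.1 = Matrix.diagonal (Function.update 1 i 2) := rfl
  have h : D * g = g * g * D := by
    apply Units.ext
    rw [Units.val_mul, Units.val_mul, Units.val_mul, hD, hg, Matrix.TransvectionStruct.toMatrix_mk,
      Matrix.transvection_mul_transvection_same i j hij]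
    ext a b
    rw [Matrix.diagonal_mul, Matrix.mul_diagonal]
    simp only [Matrix.transvection, Matrix.add_apply, Matrix.one_apply, Matrix.single_apply,
      Function.update_apply, Pi.one_apply]
    grind
  have h2 := congrArg χ h
  simp only [map_mul] at h2
  have hD0 := hpos D
  have hg0 := hpos g
  have h3 : χ D * χ g * (χ g - 1) = 0 := by linarith
  rcases mul_eq_zero.mp h3 with h4 | h4
  · exact absurd h4 (mul_pos hD0 hg0).ne'
  · linarith

/-- The invertible diagonal matrices. -/
def diagonalGL (n : ℕ) : (Fin n → ℝˣ) →* GL (Fin n) ℝ :=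
  (Units.map (Matrix.diagonalRingHom (Fin n) ℝ).toMonoidHom).comp
    MulEquiv.piUnits.symm.toMonoidHom

theorem diagonalGL_coe (d : Fin n → ℝˣ) :
    (diagonalGL n d).1 = Matrix.diagonal fun i => (d i : ℝ) := rfl

/-- The two diagonal matrices are conjugate by a permutation matrix, and `χ` takes values in a
commutative group. -/
theorem character_diagonalGL_comp (χ : GL (Fin n) ℝ →* ℝ) (hpos : ∀ g, 0 < χ g)
    (σ : Equiv.Perm (Fin n)) (d : Fin n → ℝˣ) :
    χ (diagonalGL n (d ∘ σ)) = χ (diagonalGL n d) := by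
  let P : GL (Fin n) ℝ := Matrix.GeneralLinearGroup.mkOfDetNeZero
    (σ.permMatrix ℝ) (by
      rw [Matrix.det_permutation]
      rcases Int.units_eq_one_or (Equiv.Perm.sign σ) with h | h <;> simp [h])
  have hP : P.1 = σ.toPEquiv.toMatrix := rfl
  have h : P * diagonalGL n d = diagonalGL n (d ∘ σ) * P := by
    apply Units.ext
    rw [Units.val_mul, Units.val_mul, hP, diagonalGL_coe, diagonalGL_coe,
      PEquiv.toMatrix_toPEquiv_mul, PEquiv.mul_toMatrix_toPEquiv]
    ext a b
    simp only [Matrix.submatrix_apply, id, Matrix.diagonal_apply, Function.comp]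
    grind
  have h2 := congrArg χ h
  simp only [map_mul] at h2
  have := hpos P
  nlinarith

/-- A measurable character of `ℝˣ` with positive values is a power of the absolute value. -/
theorem exists_eq_abs_rpow (ψ : ℝˣ →* ℝ) (hpos : ∀ a, 0 < ψ a)
    (hψ : Measurable fun s : ℝ => ψ (Units.mk0 (Real.exp s) (Real.exp_ne_zero s))) :
    ∃ t : ℝ, ∀ a : ℝˣ, ψ a = |(a : ℝ)| ^ t := by
  let φ : ℝ →+ ℝ :=
    { toFun := fun s => Real.log (ψ (Units.mk0 (Real.exp s) (Real.exp_ne_zero s)))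
      map_zero' := by
        have : Units.mk0 (Real.exp 0) (Real.exp_ne_zero 0) = 1 := by ext; simp
        rw [this, map_one, Real.log_one]
      map_add' := fun s u => by
        rw [← Real.log_mul (hpos _).ne' (hpos _).ne', ← map_mul]
        congr 2
        ext
        simp [Real.exp_add] }
  -- Cauchy's functional equation: a measurable additive map is continuous, hence linear.
  have hφ : Continuous φ := Measure.AddMonoidHom.continuous_of_measurable φ (Real.measurable_log.comp hψ)
  have hlin : ∀ s, φ s = s * φ 1 := fun s => by
    have := map_smul (φ.toRealLinearMap hφ) s 1
    simpa using this
  have hneg : ψ (-1) = 1 := by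
    have h : ψ (-1) * ψ (-1) = 1 := by rw [← map_mul]; simp
    nlinarith [hpos (-1)]
  have habs : ∀ a : ℝˣ, 0 < (a : ℝ) → ψ a = |(a : ℝ)| ^ φ 1 := fun a ha => by
    have h : Units.mk0 (Real.exp (Real.log a)) (Real.exp_ne_zero _) = a := by
      ext; simp [Real.exp_log ha]
    have h2 := hlin (Real.log a)
    change Real.log (ψ (Units.mk0 (Real.exp (Real.log a)) (Real.exp_ne_zero _))) = _ at h2
    rw [h] at h2
    rw [abs_of_pos ha, Real.rpow_def_of_pos ha, ← h2, Real.exp_log (hpos a)]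
  refine ⟨φ 1, fun a => ?_⟩
  rcases a.ne_zero.lt_or_gt with ha | ha
  · have h := habs (-a) (by simpa using ha)
    rw [Units.val_neg, abs_neg] at h
    rw [← h, ← neg_one_mul a, map_mul, hneg, one_mul]
  · exact habs a ha

/-- A measurable character of `GL(n, ℝ)` with positive values is a power of `|det|`. -/
theorem exists_eq_abs_det_rpow (hn : 1 ≤ n) (χ : GL (Fin n) ℝ →* ℝ) (hpos : ∀ g, 0 < χ g)
    (hχ : Measurable χ) : ∃ t : ℝ, ∀ g : GL (Fin n) ℝ, χ g = |g.1.det| ^ t := by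
  let i₀ : Fin n := ⟨0, hn⟩
  let ψ : ℝˣ →* ℝ := (χ.comp (diagonalGL n)).comp (MonoidHom.mulSingle (fun _ : Fin n => ℝˣ) i₀)
  obtain ⟨t, ht⟩ := exists_eq_abs_rpow ψ (fun a => hpos _) (by
    refine hχ.comp (Continuous.measurable ?_)
    rw [(isOpenEmbedding_generalLinear_val n).isInducing.continuous_iff]
    refine Continuous.matrix_diagonal (continuous_pi fun i => ?_)
    by_cases h : i = i₀
    · subst h
      simpa using Real.continuous_exp
    · simpa [Pi.mulSingle_eq_of_ne h] using continuous_const)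
  have hsingle : ∀ i a, χ (diagonalGL n (Pi.mulSingle i a)) = |(a : ℝ)| ^ t := fun i a => by
    rw [← ht a]
    have h := character_diagonalGL_comp χ hpos (Equiv.swap i i₀) (Pi.mulSingle i₀ a)
    have h2 : Pi.mulSingle i₀ a ∘ Equiv.swap i i₀ = Pi.mulSingle i a := by
      ext k
      simp [Pi.mulSingle_apply, Equiv.swap_apply_eq_iff]
    rwa [h2] at h
  have hdiag : ∀ d, χ (diagonalGL n d) = |(diagonalGL n d).1.det| ^ t := fun d => by
    conv_lhs => rw [← Finset.univ_prod_mulSingle d]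
    change (χ.comp (diagonalGL n)) _ = _
    rw [map_prod, diagonalGL_coe, Matrix.det_diagonal, Finset.abs_prod,
      ← Real.finsetProd_rpow _ _ fun i _ => abs_nonneg _]
    exact Finset.prod_congr rfl fun i _ => hsingle i _
  -- Every invertible matrix is a product of diagonal matrices and transvections; the predicate
  -- ranges over all units with a given underlying matrix so that the induction can run on matrices.
  refine ⟨t, fun g => ?_⟩
  refine Matrix.diagonal_transvection_induction_of_det_ne_zero
    (fun M => ∀ g : GL (Fin n) ℝ, g.1 = M → χ g = |M.det| ^ t) g.1 (det_ne_zero g) ?_ ?_ ?_ g rfl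
  · intro d hd g hg
    rw [Matrix.det_diagonal, Finset.prod_ne_zero_iff] at hd
    have : g = diagonalGL n fun i => Units.mk0 (d i) (hd i (Finset.mem_univ i)) := Units.ext hg
    rw [this, hdiag, diagonalGL_coe]
    rfl
  · intro s g hg
    rw [character_transvection χ hpos s g hg]
    simp
  · intro A B hA hB hPA hPB g hg
    have : g = Matrix.GeneralLinearGroup.mkOfDetNeZero A hA *
      Matrix.GeneralLinearGroup.mkOfDetNeZero B hB := Units.ext hg
    rw [this, map_mul, hPA _ rfl, hPB _ rfl, Matrix.det_mul, abs_mul,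
      Real.mul_rpow (abs_nonneg _) (abs_nonneg _)]

theorem detChar_apply (t : ℝ) (g : GL (Fin n) ℝ) : (detChar n t).1 g = |g.1.det| ^ t := rfl

theorem bijective_detChar (hn : 1 ≤ n) : Function.Bijective (detChar n) := by
  constructor
  · intro s t hst
    let g : GL (Fin n) ℝ := diagonalGL n
      (Pi.mulSingle ⟨0, hn⟩ (Units.mk0 (Real.exp 1) (Real.exp_ne_zero 1)))
    have hg : |g.1.det| = Real.exp 1 := by
      have : ∀ i : Fin n, ((Pi.mulSingle (M := fun _ => ℝˣ) ⟨0, hn⟩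
          (Units.mk0 (Real.exp 1) (Real.exp_ne_zero 1)) i : ℝˣ) : ℝ) =
          Pi.mulSingle (M := fun _ => ℝ) ⟨0, hn⟩ (Real.exp 1) i := fun i => by
        simp only [Pi.mulSingle_apply]
        split_ifs <;> simp
      rw [diagonalGL_coe, Matrix.det_diagonal, Finset.prod_congr rfl fun i _ => this i,
        Fintype.prod_pi_mulSingle', abs_of_pos (Real.exp_pos 1)]
    have h : (detChar n s).1 g = (detChar n t).1 g := by rw [hst]
    rw [detChar_apply, detChar_apply, hg, Real.exp_one_rpow, Real.exp_one_rpow] at h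
    exact Real.exp_injective h
  · intro χ
    obtain ⟨t, ht⟩ := exists_eq_abs_det_rpow hn χ.1 χ.2.2.1 χ.2.1.measurable
    exact ⟨t, Subtype.ext (MonoidHom.ext fun g => (ht g).symm)⟩

end Characters

/-! ### Lebesgue measure on symmetric matrices and the invariant measure -/

section Lebesgue

variable {n : ℕ}

/-- The entries on and above the diagonal as linear coordinates of `Sym(n, ℝ)`. -/
def symUpperEquiv (n : ℕ) : ({p : Fin n × Fin n // p.1 ≤ p.2} → ℝ) ≃ₗ[ℝ] SymMat n where
  toFun := symOfUpper n
  map_add' a b := rfl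
  map_smul' a b := rfl
  invFun S p := S.1 p.1.1 p.1.2
  left_inv c := by
    ext p
    simp [symOfUpper, min_eq_left p.2, max_eq_right p.2]
  right_inv S := by
    ext i j
    rcases le_total i j with h | h
    · simp [symOfUpper, h]
    · simp [symOfUpper, h, S.2.apply]

theorem continuous_symOfUpper (n : ℕ) : Continuous (symOfUpper n) :=
  Continuous.subtype_mk (continuous_pi fun _ => continuous_pi fun _ => continuous_apply _) _

/-- The coordinates of `symUpperEquiv` as a homeomorphism. -/
def symUpperHomeomorph (n : ℕ) : ({p : Fin n × Fin n // p.1 ≤ p.2} → ℝ) ≃ₜ SymMat n where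
  toEquiv := (symUpperEquiv n).toEquiv
  continuous_toFun := continuous_symOfUpper n
  continuous_invFun := continuous_pi fun p =>
    (continuous_apply_apply p.1.1 p.1.2).comp continuous_subtype_val

theorem symVolume_eq_map_homeomorph (n : ℕ) :
    symVolume n = Measure.map (symUpperHomeomorph n) volume := rfl

/-- The change of variables in `ℝ^N` is transported through the upper triangular coordinates; the
determinant does not change under conjugation. -/
theorem map_linearMap_symVolume (f : SymMat n →ₗ[ℝ] SymMat n) (hf : LinearMap.det f ≠ 0) :
    Measure.map f (symVolume n) = ENNReal.ofReal |(LinearMap.det f)⁻¹| • symVolume n := by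
  let e := symUpperEquiv n
  let F := e.symm.toLinearMap ∘ₗ f ∘ₗ e.toLinearMap
  have hdet : LinearMap.det F = LinearMap.det f := LinearMap.det_conj f e.symm
  have h := Real.map_linearMap_volume_pi_eq_smul_volume_pi (f := F) (by rwa [hdet])
  rw [hdet] at h
  have hF : Continuous F := F.continuous_on_pi
  have hfe : (f : SymMat n → SymMat n) = symOfUpper n ∘ F ∘ (symUpperHomeomorph n).symm := by
    ext1 S
    exact (congrArg f (e.apply_symm_apply S)).symm.trans (e.apply_symm_apply _).symm
  have hf : Continuous f := by
    rw [hfe]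
    exact (continuous_symOfUpper n).comp (hF.comp (symUpperHomeomorph n).symm.continuous)
  rw [symVolume, ← Measure.map_smul, ← h,
    Measure.map_map hf.measurable (continuous_symOfUpper n).measurable,
    Measure.map_map (continuous_symOfUpper n).measurable hF.measurable]
  congr 1
  ext1 c
  exact (e.apply_symm_apply _).symm

instance (n : ℕ) : IsLocallyFiniteMeasure (symVolume n) := by
  have : (Measure.map (symUpperHomeomorph n) volume).Regular :=
    Measure.Regular.map (symUpperHomeomorph n)
  rw [symVolume_eq_map_homeomorph]
  infer_instance

instance (n : ℕ) : SigmaFinite (symVolume n) :=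
  (symUpperHomeomorph n).measurableEmbedding.sigmaFinite_map

instance (n : ℕ) : (symVolume n).IsAddLeftInvariant where
  map_add_left_eq_self S := by
    have h : (fun x => S + x) ∘ symOfUpper n =
        symOfUpper n ∘ fun c => (symUpperEquiv n).symm S + c := by
      ext1 c
      have := (map_add (symUpperEquiv n) ((symUpperEquiv n).symm S) c).symm
      rwa [LinearEquiv.apply_symm_apply] at this
    have hm : Measurable fun x : SymMat n => S + x := (continuous_const_add S).measurable
    rw [symVolume, Measure.map_map hm (continuous_symOfUpper n).measurable, h,
      ← Measure.map_map (continuous_symOfUpper n).measurable (measurable_const_add _),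
      map_add_left_eq_self]

theorem symVolume_ne_zero_of_isOpen {U : Set (SymMat n)} (hU : IsOpen U) (hne : U.Nonempty) :
    symVolume n U ≠ 0 := by
  rw [symVolume, Measure.map_apply (continuous_symOfUpper n).measurable hU.measurableSet]
  refine (hU.preimage (continuous_symOfUpper n)).measure_ne_zero _ ?_
  exact hne.preimage (symUpperEquiv n).surjective

/-- Ordered positions `i ≤ j` are unordered pairs, counted by `Sym2`. -/
theorem two_mul_card_upper (n : ℕ) :
    2 * Fintype.card {p : Fin n × Fin n // p.1 ≤ p.2} = n * (n + 1) := by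
  rw [← Fintype.card_congr (Sym2.sortEquiv (α := Fin n)), Sym2.card, Fintype.card_fin,
    Nat.choose_two_right, Nat.add_sub_cancel, mul_comm (n + 1),
    Nat.mul_div_cancel' (Nat.even_mul_succ_self n).two_dvd]

theorem finrank_symMat (n : ℕ) :
    Module.finrank ℝ (SymMat n) = Fintype.card {p : Fin n × Fin n // p.1 ≤ p.2} := by
  rw [← (symUpperEquiv n).finrank_eq, Module.finrank_fintype_fun_eq_card]

theorem det_congrRep_ne_zero (g : GL (Fin n) ℝ) : LinearMap.det (congrRep n g) ≠ 0 := by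
  have h : LinearMap.det (congrRep n g) * LinearMap.det (congrRep n g⁻¹) = 1 := by
    rw [← map_mul, ← map_mul, mul_inv_cancel, map_one, map_one]
  exact left_ne_zero_of_mul_eq_one h

theorem continuous_det_congrRep (n : ℕ) :
    Continuous fun g : GL (Fin n) ℝ => LinearMap.det (congrRep n g) := by
  let b := Module.finBasis ℝ (SymMat n)
  simp_rw [← LinearMap.det_toMatrix b]
  refine Continuous.matrix_det (continuous_matrix fun i j => ?_)
  simp only [LinearMap.toMatrix_apply]
  exact (LinearMap.continuous_of_finiteDimensional (b.coord i)).comp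
    ((continuous_congrRep n).comp (continuous_id.prodMk continuous_const))

/-- The Jacobian of `S ↦ g S gᵗ` on `Sym(n, ℝ)`. -/
theorem abs_det_congrRep (hn : 1 ≤ n) (g : GL (Fin n) ℝ) :
    |LinearMap.det (congrRep n g)| = |g.1.det| ^ ((n : ℝ) + 1) := by
  let χ : GL (Fin n) ℝ →* ℝ :=
    { toFun := fun g => |LinearMap.det (congrRep n g)|
      map_one' := by simp
      map_mul' := fun a b => by rw [map_mul, map_mul, abs_mul] }
  -- The Jacobian is itself a positive continuous character, so only its exponent is unknown.
  obtain ⟨t, ht⟩ := exists_eq_abs_det_rpow hn χ (fun g => abs_pos.mpr (det_congrRep_ne_zero g))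
    (continuous_det_congrRep n).abs.measurable
  have hχ : ∀ g, χ g = |LinearMap.det (congrRep n g)| := fun _ => rfl
  suffices t = n + 1 by rw [← hχ, ht, this]
  -- The exponent is read off at the scalar `e`: it acts by `e²` on a space of dimension `n(n+1)/2`
  -- and has determinant `e^n`, so `n(n+1) = n t`.
  let s : GL (Fin n) ℝ := diagonalGL n fun _ => Units.mk0 (Real.exp 1) (Real.exp_ne_zero 1)
  have hs : s.1 = Real.exp 1 • (1 : Matrix (Fin n) (Fin n) ℝ) := by
    exact (Matrix.smul_one_eq_diagonal _).symm
  have hsdet : |s.1.det| = Real.exp n := by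
    rw [hs, Matrix.det_smul, Matrix.det_one, mul_one, Fintype.card_fin, ← Real.exp_nat_mul,
      mul_one, abs_of_pos (Real.exp_pos _)]
  have hsrep : congrRep n s = Real.exp 2 • LinearMap.id := by
    ext S : 2
    rw [congrRep_coe, hs]
    simp only [Matrix.transpose_smul, Matrix.transpose_one, Matrix.smul_mul, Matrix.mul_smul,
      one_mul, mul_one, smul_smul, ← Real.exp_add]
    norm_num
  have h := ht s
  rw [hχ, hsrep, LinearMap.det_smul, LinearMap.det_id, mul_one, hsdet, finrank_symMat,
    ← Real.exp_nat_mul, abs_of_pos (Real.exp_pos _), ← Real.exp_mul] at h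
  have h2 := Real.exp_injective h
  have h3 : ((Fintype.card {p : Fin n × Fin n // p.1 ≤ p.2} : ℕ) : ℝ) * 2 = n * (n + 1) := by
    rw [mul_comm]
    exact_mod_cast two_mul_card_upper n
  rw [h3] at h2
  have hn0 : (n : ℝ) ≠ 0 := by positivity
  exact (mul_left_cancel₀ hn0 h2).symm

theorem posVolume_apply {E : Set (SymPos n)} : posVolume n E = symVolume n (Subtype.val '' E) :=
  comap_subtype_coe_apply (isOpen_posDef n).measurableSet _ _

instance (n : ℕ) : SecondCountableTopology (SymPos n) :=
  TopologicalSpace.Subtype.secondCountableTopology {S : SymMat n | S.1.PosDef}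

instance (n : ℕ) : IsLocallyFiniteMeasure (posVolume n) where
  finiteAtNhds S := by
    obtain ⟨U, hU, hfin⟩ := (symVolume n).finiteAt_nhds S.1
    refine ⟨Subtype.val ⁻¹' U, continuous_subtype_val.continuousAt.preimage_mem_nhds hU, ?_⟩
    rw [posVolume_apply]
    exact (measure_mono (Set.image_preimage_subset _ _)).trans_lt hfin

instance (n : ℕ) : SigmaFinite (posVolume n) := inferInstance

theorem det_pos (S : SymPos n) : 0 < S.1.1.det := S.2.det_pos

theorem continuous_coe_det (n : ℕ) : Continuous fun S : SymPos n => S.1.1.det :=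
  Continuous.matrix_det (continuous_subtype_val.comp continuous_subtype_val)

theorem continuous_det_rpow (n : ℕ) (t : ℝ) : Continuous fun S : SymPos n => S.1.1.det ^ t :=
  (continuous_coe_det n).rpow_const fun S => Or.inl (det_pos S).ne'

theorem map_smul_posVolume (hn : 1 ≤ n) (g : GL (Fin n) ℝ) :
    Measure.map (g • ·) (posVolume n) =
      ENNReal.ofReal (|g.1.det| ^ (-((n : ℝ) + 1))) • posVolume n := by
  ext E hE
  have hm : Measurable fun S : SymPos n => g • S := measurable_const_smul g
  have hemb : MeasurableEmbedding (Subtype.val : SymPos n → SymMat n) :=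
    MeasurableEmbedding.subtype_coe (isOpen_posDef n).measurableSet
  have hinj : Function.Injective (congrRep n g) := fun a b hab => by
    have := congrArg (congrRep n g⁻¹) hab
    simpa [← Module.End.mul_apply, ← map_mul] using this
  have hset : Subtype.val '' ((g • ·) ⁻¹' E : Set (SymPos n)) =
      congrRep n g ⁻¹' (Subtype.val '' E) := by
    ext S
    constructor
    · rintro ⟨x, hx, rfl⟩
      exact ⟨_, hx, rfl⟩
    · rintro ⟨y, hy, hyS⟩
      refine ⟨g⁻¹ • y, by simpa using hy, hinj ?_⟩
      rw [← hyS, ← SymPos.coe_smul, smul_inv_smul]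
  have hf : Measurable (congrRep n g) :=
    ((continuous_congrRep n).comp (continuous_const.prodMk continuous_id)).measurable
  rw [Measure.map_apply hm hE, posVolume_apply, hset,
    ← Measure.map_apply hf (hemb.measurableSet_image.mpr hE),
    map_linearMap_symVolume _ (det_congrRep_ne_zero g), Measure.smul_apply, Measure.smul_apply,
    posVolume_apply, abs_inv, abs_det_congrRep hn, Real.rpow_neg (abs_nonneg _)]

theorem det_smul_symPos (g : GL (Fin n) ℝ) (S : SymPos n) :
    (g • S).1.1.det = |g.1.det| ^ 2 * S.1.1.det := by
  rw [SymPos.coe_smul, congrRep_coe, Matrix.det_mul, Matrix.det_mul, Matrix.det_transpose, sq_abs]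
  ring

/-- `det (g S gᵗ) = |det g|² det S`, so the density contributes `|det g|^(n+1)`, which cancels the
Jacobian factor of the pushforward. -/
theorem map_smul_posInvariant (hn : 1 ≤ n) (g : GL (Fin n) ℝ) :
    Measure.map (g • ·) (posInvariant n) = posInvariant n := by
  ext E hE
  have hm : Measurable fun S : SymPos n => g • S := measurable_const_smul g
  have hd : Measurable fun S : SymPos n =>
      ENNReal.ofReal (S.1.1.det ^ (-(((n : ℝ) + 1) / 2))) :=
    (continuous_det_rpow n _).measurable.ennreal_ofReal
  have hg : 0 < |g.1.det| := abs_pos.mpr (det_ne_zero g)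
  rw [Measure.map_apply hm hE, posInvariant, withDensity_apply _ (hm hE),
    withDensity_apply _ hE]
  have h1 : ∀ S : SymPos n, ENNReal.ofReal (S.1.1.det ^ (-(((n : ℝ) + 1) / 2))) =
      ENNReal.ofReal (|g.1.det| ^ ((n : ℝ) + 1)) *
        ENNReal.ofReal ((g • S).1.1.det ^ (-(((n : ℝ) + 1) / 2))) := fun S => by
    rw [← ENNReal.ofReal_mul (by positivity), det_smul_symPos,
      Real.mul_rpow (by positivity) (det_pos S).le, ← mul_assoc, ← Real.rpow_natCast,
      ← Real.rpow_mul hg.le, ← Real.rpow_add hg]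
    have h2 : (n : ℝ) + 1 + ((2 : ℕ) : ℝ) * -(((n : ℝ) + 1) / 2) = 0 := by push_cast; ring
    rw [h2, Real.rpow_zero, one_mul]
  have hdm : Measurable fun S : SymPos n =>
      ENNReal.ofReal ((g • S).1.1.det ^ (-(((n : ℝ) + 1) / 2))) := hd.comp hm
  rw [lintegral_congr h1, lintegral_const_mul _ hdm, ← setLIntegral_map hE hd hm,
    map_smul_posVolume hn,
    Measure.restrict_smul, lintegral_smul_measure, smul_eq_mul, ← mul_assoc,
    ← ENNReal.ofReal_mul (by positivity), ← Real.rpow_add hg, add_neg_cancel, Real.rpow_zero,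
    ENNReal.ofReal_one, one_mul]

instance (n : ℕ) : IsLocallyFiniteMeasure (posInvariant n) :=
  IsLocallyFiniteMeasure.withDensity_ofReal (continuous_det_rpow n _)

theorem posVolume_ne_zero (n : ℕ) : posVolume n ≠ 0 := by
  intro h
  have h2 : posVolume n Set.univ = 0 := by simp [h]
  rw [posVolume_apply, Set.image_univ] at h2
  refine symVolume_ne_zero_of_isOpen (isOpen_posDef n) ⟨_, (posOne n).2⟩
    (measure_mono_null (fun S hS => Set.mem_range.mpr ⟨⟨S, hS⟩, rfl⟩) h2)

theorem posInvariant_ne_zero (n : ℕ) : posInvariant n ≠ 0 := by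
  intro h
  rw [posInvariant, withDensity_eq_zero_iff
    (continuous_det_rpow n _).measurable.ennreal_ofReal.aemeasurable] at h
  have : ∀ᵐ _ ∂(posVolume n), False := h.mono fun S hS => by
    have := Real.rpow_pos_of_pos (det_pos S) (-(((n : ℝ) + 1) / 2))
    simp only [Pi.zero_apply, ENNReal.ofReal_eq_zero] at hS
    linarith
  simp only [Filter.eventually_false_iff_eq_bot, ae_eq_bot] at this
  exact posVolume_ne_zero n this

end Lebesgue

/-! ### Uniqueness of relatively invariant measures on homogeneous spaces -/

section Uniqueness

variable {G X : Type*} [Group G] [MeasurableSpace G] [MeasurableMul₂ G] [MeasurableInv G]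
  [MulAction G X] [MulAction.IsPretransitive G X] [MeasurableSpace X] [MeasurableSMul₂ G X]

/-- On a homogeneous space, the null sets of a quasi-invariant measure are determined by those of
a left-invariant measure on the group. -/
theorem measure_eq_zero_iff_of_quasiInvariant (ν : Measure G) [ν.IsMulLeftInvariant] [SFinite ν]
    (hν : ν ≠ 0) {μ : Measure X} [SFinite μ] (hμ : μ ≠ 0)
    (hq : ∀ (g : G) (E : Set X), MeasurableSet E → μ E = 0 → μ ((g • ·) ⁻¹' E) = 0)
    {N : Set X} (hN : MeasurableSet N) (x : X) :
    μ N = 0 ↔ ν {g | g • x ∈ N} = 0 := by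
  have hall : ∀ y, ν {g | g • y ∈ N} = 0 ↔ ν {g | g • x ∈ N} = 0 := fun y => by
    obtain ⟨k, rfl⟩ := MulAction.exists_smul_eq G x y
    -- Changing the base point is a right translation of the group, which preserves null sets of a
    -- left-invariant measure.
    rw [← measure_mul_right_null ν k (s := {g | g • x ∈ N})]
    simp only [Set.preimage_ofPred_eq, mul_smul]
  have hcomm := Measure.ae_ae_comm (μ := ν) (ν := μ) (p := fun g y => g • y ∉ N)
    (measurable_smul hN.compl)
  have hνe : Filter.NeBot (ae ν) := ae_neBot.mpr hν
  have hμe : Filter.NeBot (ae μ) := ae_neBot.mpr hμ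
  constructor
  · intro h
    -- Fubini turns "for every `g`, almost every `y`" into "for almost every `y`, almost every `g`";
    -- a single such `y` suffices.
    obtain ⟨y, hy⟩ := (hcomm.mp (ae_of_all _ fun g => by
      simpa [ae_iff, Set.preimage] using hq g N hN h)).exists
    refine (hall y).mp ?_
    simpa [ae_iff] using hy
  · intro h
    obtain ⟨g, hg⟩ := (hcomm.mpr (ae_of_all _ fun y => by
      simpa [ae_iff] using (hall y).mpr h)).exists
    have h2 := hq g⁻¹ ((g • ·) ⁻¹' N) (measurable_const_smul g hN)
      (by simpa [ae_iff, Set.preimage] using hg)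
    simpa [Set.preimage_preimage] using h2

/-- On a homogeneous space, a relatively invariant measure is determined up to a scalar by its
multiplier. -/
theorem exists_eq_smul_of_relInvariant (ν : Measure G) [ν.IsMulLeftInvariant] [SFinite ν]
    (hν : ν ≠ 0) {μ₁ μ₂ : Measure X} [SigmaFinite μ₁] [SigmaFinite μ₂] (h₁ : μ₁ ≠ 0) (h₂ : μ₂ ≠ 0)
    (c : G → ℝ≥0∞) (hc₁ : ∀ g, Measure.map (g • ·) μ₁ = c g • μ₁)
    (hc₂ : ∀ g, Measure.map (g • ·) μ₂ = c g • μ₂) :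
    ∃ k : ℝ≥0∞, k ≠ 0 ∧ k ≠ ∞ ∧ μ₁ = k • μ₂ := by
  have hsm : ∀ g : G, Measurable fun x : X => g • x := fun g => measurable_const_smul g
  have hq : ∀ μ : Measure X, (∀ g, Measure.map (g • ·) μ = c g • μ) →
      ∀ (g : G) (E : Set X), MeasurableSet E → μ E = 0 → μ ((g • ·) ⁻¹' E) = 0 := by
    intro μ hμ g E hE h
    rw [← Measure.map_apply (hsm g) hE, hμ, Measure.smul_apply, h, smul_zero]
  obtain ⟨x₀⟩ : Nonempty X := by
    by_contra hX
    rw [not_nonempty_iff] at hX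
    exact h₁ (Measure.eq_zero_of_isEmpty μ₁)
  have hac : μ₁ ≪ μ₂ := Measure.AbsolutelyContinuous.mk fun N hN h =>
    (measure_eq_zero_iff_of_quasiInvariant ν hν h₁ (hq μ₁ hc₁) hN x₀).mpr
      ((measure_eq_zero_iff_of_quasiInvariant ν hν h₂ (hq μ₂ hc₂) hN x₀).mp h)
  let f := μ₁.rnDeriv μ₂
  have hf : Measurable f := Measure.measurable_rnDeriv _ _
  -- Both measures have the same multiplier, so the density is invariant under each `g`, with an
  -- exceptional null set depending on `g`.
  have hinv : ∀ g : G, ∀ᵐ x ∂μ₂, f (g • x) = f x := fun g => by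
    refine ae_eq_of_forall_setLIntegral_eq_of_sigmaFinite (hf.comp (hsm g)) hf fun s hs _ => ?_
    have hs2 : s = (g • ·) ⁻¹' ((g⁻¹ • ·) ⁻¹' s) := by simp [Set.preimage_preimage]
    have hs3 : MeasurableSet ((g⁻¹ • ·) ⁻¹' s : Set X) := hsm g⁻¹ hs
    rw [Measure.setLIntegral_rnDeriv hac, hs2, ← setLIntegral_map hs3 hf (hsm g), hc₂,
      Measure.restrict_smul, lintegral_smul_measure, Measure.setLIntegral_rnDeriv hac,
      ← Measure.smul_apply, ← hc₁, Measure.map_apply (hsm g) hs3]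
  have hμe : Filter.NeBot (ae μ₂) := ae_neBot.mpr h₂
  have hmeas : MeasurableSet {p : G × X | f (p.1 • p.2) = f p.2} :=
    measurableSet_eq_fun (hf.comp measurable_smul) (hf.comp measurable_snd)
  -- Fubini gives one base point `x` with `f (g • x) = f x` for almost every `g`; the null set
  -- criterion at `x` then makes `f` almost everywhere constant.
  obtain ⟨x, hx⟩ := ((Measure.ae_ae_comm (μ := ν) (ν := μ₂) hmeas).mp (ae_of_all _ hinv)).exists
  have hconst : ∀ᵐ y ∂μ₂, f y = f x := by
    have hN : MeasurableSet {y | f y ≠ f x} := (hf (measurableSet_singleton (f x))).compl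
    exact (measure_eq_zero_iff_of_quasiInvariant ν hν h₂ (hq μ₂ hc₂) hN x).mpr hx
  have heq : μ₁ = f x • μ₂ := by
    rw [← Measure.withDensity_rnDeriv_eq _ _ hac, withDensity_congr_ae hconst, withDensity_const]
  refine ⟨f x, fun h => h₁ (by rw [heq, h, zero_smul]), fun h => ?_, heq⟩
  obtain ⟨y, hy, hy2⟩ := (hconst.and (Measure.rnDeriv_lt_top μ₁ μ₂)).exists
  exact hy2.ne (hy.trans h)

end Uniqueness

/-! ### Gamma and Gaussian integrals with values in `[0, ∞]` -/

section OneVariable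

/-- The Gamma integral `∫₀^∞ exp(-l a) a^(s-1) da`, with values in `[0, ∞]`. -/
def gammaLIntegral (l s : ℝ) : ℝ≥0∞ :=
  ∫⁻ a in Set.Ioi (0 : ℝ), ENNReal.ofReal (Real.exp (-(l * a)) * a ^ (s - 1))

/-- The Gaussian integral `∫ exp(-l b²) db`, with values in `[0, ∞]`. -/
def gaussLIntegral (l : ℝ) : ℝ≥0∞ := ∫⁻ b : ℝ, ENNReal.ofReal (Real.exp (-l * b ^ 2))

theorem measurable_exp_mul_rpow (l s : ℝ) :
    Measurable fun a : ℝ => Real.exp (-(l * a)) * a ^ (s - 1) := by fun_prop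

theorem gammaLIntegral_eq {l s : ℝ} (hl : 0 < l) (hs : 0 < s) :
    gammaLIntegral l s = ENNReal.ofReal (Real.Gamma s * l ^ (-s)) := by
  have h := Real.integral_rpow_mul_exp_neg_mul_Ioi hs hl
  simp_rw [mul_comm _ (Real.exp _)] at h
  have hval : (1 / l) ^ s * Real.Gamma s = Real.Gamma s * l ^ (-s) := by
    rw [one_div, Real.inv_rpow hl.le, Real.rpow_neg hl.le, mul_comm]
  have hpos : 0 < Real.Gamma s * l ^ (-s) :=
    mul_pos (Real.Gamma_pos_of_pos hs) (Real.rpow_pos_of_pos hl _)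
  rw [hval] at h
  rw [gammaLIntegral, ← h, ofReal_integral_eq_lintegral_ofReal]
  -- The integral of a non-integrable function is `0` by convention, whereas the value here is
  -- positive.
  · by_contra hi
    rw [integral_undef hi] at h
    exact hpos.ne h
  · exact ae_restrict_of_forall_mem measurableSet_Ioi fun _ ha =>
      mul_nonneg (Real.exp_pos _).le (Real.rpow_nonneg (le_of_lt ha) _)

theorem integrable_of_gammaLIntegral_ne_top {l s : ℝ} (h : gammaLIntegral l s ≠ ∞) :
    IntegrableOn (fun a : ℝ => Real.exp (-(l * a)) * a ^ (s - 1)) (Set.Ioi 0) :=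
  (lintegral_ofReal_ne_top_iff_integrable (measurable_exp_mul_rpow l s).aestronglyMeasurable
    (ae_restrict_of_forall_mem measurableSet_Ioi fun _ ha =>
      mul_nonneg (Real.exp_pos _).le (Real.rpow_nonneg (le_of_lt ha) _))).mp h

/-- If `l ≤ 0` the integrand dominates a pure power, and no power is integrable on the half line.
Once `l > 0`, the exponential is at least `exp(-l)` on `(0, 1)`, so integrability near `0` forces `s
> 0`. -/
theorem pos_of_gammaLIntegral_ne_top {l s : ℝ} (h : gammaLIntegral l s ≠ ∞) : 0 < l ∧ 0 < s := by
  have hi := integrable_of_gammaLIntegral_ne_top h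
  have hm : ∀ c : ℝ, Measurable fun a : ℝ => c * a ^ (s - 1) := fun c => by fun_prop
  have hl : 0 < l := by
    by_contra hl
    refine not_integrableOn_Ioi_rpow (s - 1) (hi.mono' ?_ ?_)
    · simpa using (hm 1).aestronglyMeasurable
    · refine ae_restrict_of_forall_mem measurableSet_Ioi fun a ha => ?_
      have ha' : (0 : ℝ) < a := ha
      have := Real.rpow_nonneg ha'.le (s - 1)
      rw [Real.norm_of_nonneg this]
      refine le_mul_of_one_le_left this (Real.one_le_exp ?_)
      nlinarith
  refine ⟨hl, ?_⟩
  have h2 : IntegrableOn (fun a : ℝ => Real.exp (-l) * a ^ (s - 1)) (Set.Ioo 0 1) := by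
    refine (hi.mono_set Set.Ioo_subset_Ioi_self).mono' (hm _).aestronglyMeasurable ?_
    refine ae_restrict_of_forall_mem measurableSet_Ioo fun a ha => ?_
    have := Real.rpow_nonneg ha.1.le (s - 1)
    rw [Real.norm_of_nonneg (by positivity)]
    refine mul_le_mul_of_nonneg_right (Real.exp_le_exp.mpr ?_) this
    nlinarith [ha.2]
  have h3 : IntegrableOn (fun a : ℝ => a ^ (s - 1)) (Set.Ioo 0 1) := by
    have h4 := h2.const_mul (Real.exp l)
    simp_rw [← mul_assoc, ← Real.exp_add, add_neg_cancel, Real.exp_zero, one_mul] at h4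
    exact h4
  rw [intervalIntegral.integrableOn_Ioo_rpow_iff zero_lt_one] at h3
  linarith

theorem gammaLIntegral_ne_zero (l s : ℝ) : gammaLIntegral l s ≠ 0 := by
  by_cases h : gammaLIntegral l s = ∞
  · simp [h]
  · obtain ⟨hl, hs⟩ := pos_of_gammaLIntegral_ne_top h
    rw [gammaLIntegral_eq hl hs]
    simpa using mul_pos (Real.Gamma_pos_of_pos hs) (Real.rpow_pos_of_pos hl (-s))

theorem gaussLIntegral_eq {l : ℝ} (hl : 0 < l) :
    gaussLIntegral l = ENNReal.ofReal (√(Real.pi / l)) := by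
  rw [gaussLIntegral, ← integral_gaussian l, ofReal_integral_eq_lintegral_ofReal
    (integrable_exp_neg_mul_sq hl) (ae_of_all _ fun b => (Real.exp_pos _).le)]

theorem gaussLIntegral_ne_top_iff {l : ℝ} : gaussLIntegral l ≠ ∞ ↔ 0 < l := by
  rw [gaussLIntegral, lintegral_ofReal_ne_top_iff_integrable
    (by fun_prop) (ae_of_all _ fun b => (Real.exp_pos _).le), integrable_exp_neg_mul_sq_iff]

theorem gaussLIntegral_ne_zero (l : ℝ) : gaussLIntegral l ≠ 0 := by
  by_cases h : gaussLIntegral l = ∞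
  · simp [h]
  · have hl := gaussLIntegral_ne_top_iff.mp h
    rw [gaussLIntegral_eq hl]
    simpa using div_pos Real.pi_pos hl

/-- For `l ≤ 0` both sides are `∞`, so the recursion below needs no sign condition on `l`. -/
theorem gaussLIntegral_div (l : ℝ) {a : ℝ} (ha : 0 < a) :
    gaussLIntegral (l / a) = ENNReal.ofReal √a * gaussLIntegral l := by
  by_cases hl : 0 < l
  · rw [gaussLIntegral_eq hl, gaussLIntegral_eq (div_pos hl ha),
      ← ENNReal.ofReal_mul (Real.sqrt_nonneg _), ← Real.sqrt_mul ha.le]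
    congr 2
    field_simp
  · have h1 : gaussLIntegral l = ∞ := by
      by_contra h
      exact hl (gaussLIntegral_ne_top_iff.mp h)
    have h2 : gaussLIntegral (l / a) = ∞ := by
      by_contra h
      exact hl ((div_pos_iff_of_pos_right ha).mp (gaussLIntegral_ne_top_iff.mp h))
    rw [h1, h2, ENNReal.mul_top (by simpa using ha)]

theorem lintegral_fin_prod {n : ℕ} (f : Fin n → ℝ → ℝ≥0∞) (hf : ∀ i, Measurable (f i)) :
    ∫⁻ b : Fin n → ℝ, ∏ i, f i (b i) = ∏ i, ∫⁻ x, f i x := by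
  induction n with
  | zero => simp [lintegral_const, volume_pi]
  | succ n ih =>
    have hp := (volume_preserving_piFinSuccAbove (fun _ : Fin (n + 1) => ℝ) 0).symm
    rw [← hp.lintegral_comp_emb (MeasurableEquiv.measurableEmbedding _), Fin.prod_univ_succ,
      ← ih _ fun i => hf i.succ, ← lintegral_prod_mul (hf 0).aemeasurable]
    · refine lintegral_congr fun z => ?_
      rw [Fin.prod_univ_succ]
      rfl
    · exact (Finset.measurable_prod _ fun i _ =>
        (hf i.succ).comp (measurable_pi_apply i)).aemeasurable

end OneVariable

/-! ### Splitting off the first row of a symmetric matrix -/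

section ConsSym

variable {n : ℕ}

/-- The symmetric matrix with first row `(a, b)` and lower right block `C`. -/
def consSym (a : ℝ) (b : Fin n → ℝ) (C : SymMat n) : SymMat (n + 1) :=
  ⟨Matrix.of (Fin.cons (Fin.cons a b) fun i => Fin.cons (b i) (C.1 i)), by
    ext i j
    refine Fin.cases ?_ (fun i => ?_) i <;> refine Fin.cases ?_ (fun j => ?_) j
    · rfl
    · simp [Matrix.transpose_apply]
    · simp [Matrix.transpose_apply]
    · simpa [Matrix.transpose_apply] using C.2.apply i j⟩

@[simp] theorem consSym_zero_zero (a : ℝ) (b : Fin n → ℝ) (C : SymMat n) :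
    (consSym a b C).1 0 0 = a := rfl

@[simp] theorem consSym_zero_succ (a : ℝ) (b : Fin n → ℝ) (C : SymMat n) (j : Fin n) :
    (consSym a b C).1 0 j.succ = b j := rfl

@[simp] theorem consSym_succ_zero (a : ℝ) (b : Fin n → ℝ) (C : SymMat n) (i : Fin n) :
    (consSym a b C).1 i.succ 0 = b i := rfl

@[simp] theorem consSym_succ_succ (a : ℝ) (b : Fin n → ℝ) (C : SymMat n) (i j : Fin n) :
    (consSym a b C).1 i.succ j.succ = C.1 i j := rfl

theorem continuous_consSym :
    Continuous fun z : ℝ × (Fin n → ℝ) × SymMat n => consSym z.1 z.2.1 z.2.2 := by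
  have h1 : Continuous fun z : ℝ × (Fin n → ℝ) × SymMat n => z.1 := by fun_prop
  have h2 : Continuous fun z : ℝ × (Fin n → ℝ) × SymMat n => z.2.1 := by fun_prop
  have h3 : Continuous fun z : ℝ × (Fin n → ℝ) × SymMat n => z.2.2.1 := by fun_prop
  refine Continuous.subtype_mk (continuous_matrix fun i j => ?_) _
  refine Fin.cases ?_ (fun i => ?_) i <;> refine Fin.cases ?_ (fun j => ?_) j
  · exact h1
  · exact (continuous_apply j).comp h2
  · exact (continuous_apply i).comp h2
  · exact (continuous_apply_apply i j).comp h3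

/-- The upper triangular positions of size `n + 1`: the corner, the rest of the first row, and
the upper triangular positions of size `n`. -/
def upperSuccEquiv (n : ℕ) : (Unit ⊕ Fin n) ⊕ {p : Fin n × Fin n // p.1 ≤ p.2} ≃
    {p : Fin (n + 1) × Fin (n + 1) // p.1 ≤ p.2} :=
  Equiv.ofBijective
    (Sum.elim
      (Sum.elim (fun _ => ⟨(0, 0), le_rfl⟩) (fun i => ⟨(0, i.succ), Fin.zero_le _⟩))
      (fun p => ⟨(p.1.1.succ, p.1.2.succ), Fin.succ_le_succ_iff.mpr p.2⟩)) (by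
    constructor
    · rintro ((_ | i) | ⟨⟨i, j⟩, hij⟩) ((_ | i') | ⟨⟨i', j'⟩, hij'⟩) h <;>
        simp [Prod.ext_iff] at h ⊢ <;> grind
    · rintro ⟨⟨i, j⟩, hij⟩
      revert hij
      refine Fin.cases ?_ (fun i => ?_) i <;> refine Fin.cases ?_ (fun j => ?_) j <;> intro hij
      · exact ⟨.inl (.inl ()), rfl⟩
      · exact ⟨.inl (.inr j), rfl⟩
      · simp at hij
      · exact ⟨.inr ⟨(i, j), Fin.succ_le_succ_iff.mp hij⟩, rfl⟩)

theorem lintegral_symVolume_succ (F : SymMat (n + 1) → ℝ≥0∞) (hF : Measurable F) :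
    ∫⁻ S, F S ∂(symVolume (n + 1)) =
      ∫⁻ a : ℝ, ∫⁻ b : Fin n → ℝ, ∫⁻ C, F (consSym a b C) ∂(symVolume n) := by
  have hm := (continuous_symOfUpper n).measurable
  have hcons : Measurable fun z : ℝ × (Fin n → ℝ) × SymMat n => F (consSym z.1 z.2.1 z.2.2) :=
    hF.comp continuous_consSym.measurable
  have h1 := volume_measurePreserving_piCongrLeft (fun _ => ℝ) (upperSuccEquiv n)
  have h2 := volume_measurePreserving_sumPiEquivProdPi_symm
    (fun _ : (Unit ⊕ Fin n) ⊕ {p : Fin n × Fin n // p.1 ≤ p.2} => ℝ)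
  have h3 := volume_measurePreserving_sumPiEquivProdPi_symm (fun _ : Unit ⊕ Fin n => ℝ)
  -- The coordinate reindexings, all measure preserving, assemble exactly to `consSym`; Tonelli then
  -- gives the iterated integral.
  have key : ∀ (a : Unit → ℝ) (b : Fin n → ℝ) (c : {p : Fin n × Fin n // p.1 ≤ p.2} → ℝ),
      symOfUpper (n + 1) (MeasurableEquiv.piCongrLeft (fun _ => ℝ) (upperSuccEquiv n)
        ((MeasurableEquiv.sumPiEquivProdPi fun _ => ℝ).symm
          ((MeasurableEquiv.sumPiEquivProdPi fun _ => ℝ).symm (a, b), c))) =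
      consSym (a ()) b (symOfUpper n c) := by
    intro a b c
    have hap : ∀ (v : (Unit ⊕ Fin n) ⊕ {p : Fin n × Fin n // p.1 ≤ p.2} → ℝ) k,
        MeasurableEquiv.piCongrLeft (fun _ => ℝ) (upperSuccEquiv n) v (upperSuccEquiv n k) = v k :=
      fun v k => Equiv.piCongrLeft_apply_apply (fun _ => ℝ) (upperSuccEquiv n) v k
    have hentry : ∀ (v : {p : Fin (n + 1) × Fin (n + 1) // p.1 ≤ p.2} → ℝ) (i j : Fin (n + 1)) k,
        (min i j, max i j) = (upperSuccEquiv n k).1 →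
          (symOfUpper (n + 1) v).1 i j = v (upperSuccEquiv n k) :=
      fun v i j k h => congrArg v (Subtype.ext h)
    apply Subtype.ext
    ext i j
    refine Fin.cases ?_ (fun i => ?_) i <;> refine Fin.cases ?_ (fun j => ?_) j
    · rw [hentry _ _ _ (.inl (.inl ())) (by simp; rfl), hap]
      rfl
    · rw [hentry _ _ _ (.inl (.inr j)) (by simp; rfl), hap]
      rfl
    · rw [hentry _ _ _ (.inl (.inr i)) (by simp; rfl), hap]
      rfl
    · rw [hentry _ _ _ (.inr ⟨(min i j, max i j), min_le_max⟩)
        (by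
          have hmono : Monotone (Fin.succ : Fin n → Fin (n + 1)) :=
            (Fin.strictMono_succ).monotone
          rw [← hmono.map_min, ← hmono.map_max]
          rfl), hap]
      rfl
  let S₂ := (MeasurableEquiv.sumPiEquivProdPi
    fun _ : (Unit ⊕ Fin n) ⊕ {p : Fin n × Fin n // p.1 ≤ p.2} => ℝ).symm
  let S₃ := (MeasurableEquiv.sumPiEquivProdPi fun _ : Unit ⊕ Fin n => ℝ).symm
  let f : (Unit ⊕ Fin n → ℝ) × ({p : Fin n × Fin n // p.1 ≤ p.2} → ℝ) → ℝ≥0∞ := fun z =>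
    F (symOfUpper (n + 1) (MeasurableEquiv.piCongrLeft (fun _ => ℝ) (upperSuccEquiv n) (S₂ z)))
  have hf : Measurable f :=
    hF.comp ((continuous_symOfUpper (n + 1)).measurable.comp (h1.measurable.comp h2.measurable))
  have hg : Measurable fun u => ∫⁻ c, f (u, c) := hf.lintegral_prod_right'
  calc ∫⁻ S, F S ∂(symVolume (n + 1))
      = ∫⁻ v, F (symOfUpper (n + 1) v) :=
        lintegral_map hF (continuous_symOfUpper (n + 1)).measurable
    _ = ∫⁻ w, F (symOfUpper (n + 1)
          (MeasurableEquiv.piCongrLeft (fun _ => ℝ) (upperSuccEquiv n) w)) :=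
        (h1.lintegral_comp_emb (MeasurableEquiv.measurableEmbedding _) _).symm
    _ = ∫⁻ z, f z := (h2.lintegral_comp_emb (MeasurableEquiv.measurableEmbedding _) _).symm
    _ = ∫⁻ u, ∫⁻ c, f (u, c) := lintegral_prod _ hf.aemeasurable
    _ = ∫⁻ ab, ∫⁻ c, f (S₃ ab, c) :=
        (h3.lintegral_comp_emb (MeasurableEquiv.measurableEmbedding _) _).symm
    _ = ∫⁻ a : Unit → ℝ, ∫⁻ b, ∫⁻ c, f (S₃ (a, b), c) :=
        lintegral_prod _ (hg.comp h3.measurable).aemeasurable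
    _ = ∫⁻ a : Unit → ℝ, ∫⁻ b, ∫⁻ c, F (consSym (a ()) b (symOfUpper n c)) := by
        simp only [f, S₂, S₃, key]
    _ = ∫⁻ a : ℝ, ∫⁻ b, ∫⁻ c, F (consSym a b (symOfUpper n c)) :=
        (volume_preserving_funUnique Unit ℝ).lintegral_comp_emb
          (MeasurableEquiv.measurableEmbedding _)
          (fun a : ℝ => ∫⁻ b, ∫⁻ c, F (consSym a b (symOfUpper n c)))
    _ = _ := by
        refine lintegral_congr fun a => lintegral_congr fun b => ?_
        rw [symVolume, lintegral_map _ hm]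
        exact hcons.comp (measurable_const.prodMk (measurable_const.prodMk measurable_id))

end ConsSym

/-! ### Completing the square: quadratic form, positivity and determinant -/

section Shear

variable {n : ℕ}

/-- The symmetric matrix `b bᵗ`. -/
def symVecMulVec (b : Fin n → ℝ) : SymMat n :=
  ⟨Matrix.vecMulVec b b, by
    ext i j
    simp [Matrix.vecMulVec_apply, mul_comm]⟩

theorem dotProduct_mulVec_consSym (a : ℝ) (b : Fin n → ℝ) (C : SymMat n) (v : Fin (n + 1) → ℝ) :
    v ⬝ᵥ (consSym a b C).1.mulVec v =
      a * v 0 ^ 2 + 2 * v 0 * (b ⬝ᵥ fun i => v i.succ) +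
        (fun i => v i.succ) ⬝ᵥ C.1.mulVec fun i => v i.succ := by
  simp only [dotProduct, Matrix.mulVec, Fin.sum_univ_succ, consSym_zero_zero, consSym_zero_succ,
    consSym_succ_zero, consSym_succ_succ, mul_add, Finset.sum_add_distrib]
  have h1 : ∑ i : Fin n, v i.succ * (b i * v 0) = v 0 * ∑ i, b i * v i.succ := by
    rw [Finset.mul_sum]
    exact Finset.sum_congr rfl fun i _ => by ring
  rw [h1]
  ring

/-- Completing the square in `v 0`: in these coordinates `C` is the Schur complement of the corner
`a`. -/
theorem dotProduct_mulVec_consSym_shear {a : ℝ} (ha : a ≠ 0) (b : Fin n → ℝ) (C : SymMat n)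
    (v : Fin (n + 1) → ℝ) :
    v ⬝ᵥ (consSym a b (a⁻¹ • symVecMulVec b + C)).1.mulVec v =
      a * (v 0 + a⁻¹ * (b ⬝ᵥ fun i => v i.succ)) ^ 2 +
        (fun i => v i.succ) ⬝ᵥ C.1.mulVec fun i => v i.succ := by
  rw [dotProduct_mulVec_consSym]
  have h : (a⁻¹ • symVecMulVec b + C).1 = a⁻¹ • Matrix.vecMulVec b b + C.1 := rfl
  set w : Fin n → ℝ := fun i => v i.succ
  rw [h, Matrix.add_mulVec, dotProduct_add, Matrix.smul_mulVec, dotProduct_smul,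
    Matrix.vecMulVec_mulVec, dotProduct_smul, dotProduct_comm w b]
  simp only [MulOpposite.smul_eq_mul_unop, MulOpposite.unop_op, smul_eq_mul]
  field_simp
  ring

theorem posDef_consSym_shear_iff (a : ℝ) (b : Fin n → ℝ) (C : SymMat n) :
    (consSym a b (a⁻¹ • symVecMulVec b + C)).1.PosDef ↔ 0 < a ∧ C.1.PosDef := by
  by_cases ha : 0 < a
  · simp only [ha, true_and, symMat_posDef_iff, dotProduct_mulVec_consSym_shear ha.ne']
    constructor
    · intro h w hw
      -- The first coordinate is chosen to make the completed square vanish.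
      have := h (Fin.cons (-(a⁻¹ * (b ⬝ᵥ w))) w) fun h0 => hw (by
        ext i
        exact congrFun h0 i.succ)
      simpa using this
    · intro h v hv
      by_cases hw : (fun i => v i.succ) = (0 : Fin n → ℝ)
      · rw [hw]
        have h0 : v 0 ≠ 0 := fun h0 => hv (by
          ext i
          refine Fin.cases h0 (fun i => congrFun hw i) i)
        simp only [dotProduct_zero, zero_dotProduct, mul_zero, add_zero]
        positivity
      · have := h _ hw
        positivity
  · simp only [ha, false_and, iff_false]
    exact fun h => ha (h.diag_pos (i := 0))

theorem det_consSym_shear {a : ℝ} (ha : a ≠ 0) (b : Fin n → ℝ) (C : SymMat n) :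
    (consSym a b (a⁻¹ • symVecMulVec b + C)).1.det = a * C.1.det := by
  -- `B` is what remains after subtracting `a⁻¹ b_i` times the first row from each later row; its
  -- first column is zero below the corner.
  let B : Matrix (Fin (n + 1)) (Fin (n + 1)) ℝ :=
    Matrix.of (Fin.cons (Fin.cons a b) fun i => Fin.cons 0 (C.1 i))
  have hB : (consSym a b (a⁻¹ • symVecMulVec b + C)).1.det = B.det := by
    refine Matrix.det_eq_of_forall_row_eq_smul_add_const (Fin.cons 0 fun i => a⁻¹ * b i) 0 rfl ?_
    intro i j
    refine Fin.cases ?_ (fun i => ?_) i <;> refine Fin.cases ?_ (fun j => ?_) j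
    · simp [B]
    · simp [B]
    · simp [B]
      field_simp
    · simp [B, symVecMulVec, Matrix.vecMulVec_apply]
      ring
  rw [hB, Matrix.det_succ_column_zero, Fin.sum_univ_succ]
  have hsub : B.submatrix (Fin.succAbove 0) Fin.succ = C.1 := by
    ext i j
    simp [B]
  rw [Finset.sum_eq_zero fun i _ => by simp [B], hsub]
  simp [B]

end Shear

/-! ### The integral for a diagonal parameter, by recursion on the size -/

section Recursion

variable {n : ℕ}

/-- The density of the unnormalized Wishart distribution with diagonal parameter `l`, extended by
zero to all symmetric matrices. -/
def diagDensity (n : ℕ) (l : Fin n → ℝ) (s : ℝ) : SymMat n → ℝ≥0∞ :=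
  {S : SymMat n | S.1.PosDef}.indicator fun S =>
    ENNReal.ofReal (Real.exp (-∑ i, l i * S.1 i i) * S.1.det ^ (s - ((n : ℝ) + 1) / 2))

/-- The normalizing constant of the Wishart distribution with diagonal parameter `l`, with values
in `[0, ∞]`. -/
def diagLIntegral (n : ℕ) (l : Fin n → ℝ) (s : ℝ) : ℝ≥0∞ :=
  ∫⁻ S, diagDensity n l s S ∂(symVolume n)

theorem measurable_diagDensity (l : Fin n → ℝ) (s : ℝ) : Measurable (diagDensity n l s) := by
  refine Measurable.indicator (Measurable.ennreal_ofReal (Measurable.mul ?_ ?_))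
    (isOpen_posDef n).measurableSet
  · have : Continuous fun S : SymMat n => ∑ i, l i * S.1 i i :=
      continuous_finsetSum _ fun i _ => continuous_const.mul
        ((continuous_apply_apply i i).comp continuous_subtype_val)
    exact (Real.continuous_exp.comp this.neg).measurable
  · have : Continuous fun S : SymMat n => S.1.det := continuous_subtype_val.matrix_det
    exact this.measurable.pow_const _

/-- The shift adds `b_i² / a` to the diagonal entries, which gives the Gaussians, and the
determinant is `a det C`. The exponent of `det C` remains `s - (n+2)/2`; in size `n` this
corresponds to the parameter `s - 1/2`. -/
theorem diagDensity_consSym_shear (l : Fin (n + 1) → ℝ) (s a : ℝ) (b : Fin n → ℝ) (C : SymMat n) :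
    diagDensity (n + 1) l s (consSym a b (a⁻¹ • symVecMulVec b + C)) =
      (Set.Ioi (0 : ℝ)).indicator (fun a => ENNReal.ofReal
        (Real.exp (-(l 0 * a)) * a ^ (s - ((n : ℝ) + 2) / 2))) a *
        ((∏ i, ENNReal.ofReal (Real.exp (-(l i.succ / a) * b i ^ 2))) *
          diagDensity n (fun i => l i.succ) (s - 1 / 2) C) := by
  have hiff := posDef_consSym_shear_iff a b C
  by_cases ha : 0 < a
  swap
  · rw [diagDensity, Set.indicator_of_notMem (by simp [hiff, ha]),
      Set.indicator_of_notMem (by simpa using ha), zero_mul]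
  by_cases hC : C.1.PosDef
  swap
  · have h1 : diagDensity (n + 1) l s (consSym a b (a⁻¹ • symVecMulVec b + C)) = 0 :=
      Set.indicator_of_notMem (by simp [hiff, hC]) _
    have h2 : diagDensity n (fun i => l i.succ) (s - 1 / 2) C = 0 :=
      Set.indicator_of_notMem (by simpa using hC) _
    rw [h1, h2, mul_zero, mul_zero]
  rw [diagDensity, Set.indicator_of_mem (by simp [hiff, ha, hC]), diagDensity,
    Set.indicator_of_mem (by simpa using ha), Set.indicator_of_mem (by simpa using hC),
    ← ENNReal.ofReal_prod_of_nonneg fun i _ => (Real.exp_pos _).le, ← Real.exp_sum,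
    ← ENNReal.ofReal_mul (Real.exp_pos _).le, ← ENNReal.ofReal_mul (by positivity),
    det_consSym_shear ha.ne', Real.mul_rpow ha.le hC.det_pos.le]
  have hsum : -∑ i, l i * (consSym a b (a⁻¹ • symVecMulVec b + C)).1 i i =
      -(l 0 * a) + (∑ i : Fin n, -(l i.succ / a) * b i ^ 2 + -∑ i : Fin n, l i.succ * C.1 i i) := by
    rw [Fin.sum_univ_succ, ← Finset.sum_neg_distrib, ← Finset.sum_add_distrib, neg_add,
      ← Finset.sum_neg_distrib]
    congr 1
    refine Finset.sum_congr rfl fun i _ => ?_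
    simp [symVecMulVec, Matrix.vecMulVec_apply]
    field_simp
    ring
  have he1 : s - (((n + 1 : ℕ) : ℝ) + 1) / 2 = s - ((n : ℝ) + 2) / 2 := by push_cast; ring
  have he2 : s - 1 / 2 - ((n : ℝ) + 1) / 2 = s - ((n : ℝ) + 2) / 2 := by ring
  rw [hsum, Real.exp_add, Real.exp_add, he1, he2]
  congr 1
  ring

theorem diagLIntegral_zero (l : Fin 0 → ℝ) (s : ℝ) : diagLIntegral 0 l s = 1 := by
  have h : ∀ S : SymMat 0, diagDensity 0 l s S = 1 := fun S => by
    have hS : S.1.PosDef := (symMat_posDef_iff S).mpr fun v hv => absurd (Subsingleton.elim v 0) hv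
    refine (Set.indicator_of_mem (s := {S : SymMat 0 | S.1.PosDef}) hS _).trans ?_
    simp
  rw [diagLIntegral, lintegral_congr h, lintegral_one, symVolume,
    Measure.map_apply (continuous_symOfUpper 0).measurable MeasurableSet.univ, Set.preimage_univ,
    volume_pi, Measure.pi_univ, Finset.univ_eq_empty, Finset.prod_empty]

theorem diagLIntegral_succ (l : Fin (n + 1) → ℝ) (s : ℝ) :
    diagLIntegral (n + 1) l s = gammaLIntegral (l 0) s *
      ((∏ i : Fin n, gaussLIntegral (l i.succ)) *
        diagLIntegral n (fun i => l i.succ) (s - 1 / 2)) := by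
  have hC : ∀ (a : ℝ) (b : Fin n → ℝ),
      ∫⁻ C, diagDensity (n + 1) l s (consSym a b C) ∂(symVolume n) =
        (Set.Ioi (0 : ℝ)).indicator (fun a => ENNReal.ofReal
          (Real.exp (-(l 0 * a)) * a ^ (s - ((n : ℝ) + 2) / 2))) a *
        ((∏ i, ENNReal.ofReal (Real.exp (-(l i.succ / a) * b i ^ 2))) *
          diagLIntegral n (fun i => l i.succ) (s - 1 / 2)) := fun a b => by
    -- For fixed `a` and `b` the shear is a translation in `C`, hence preserves Lebesgue measure.
    rw [← lintegral_add_left_eq_self _ (a⁻¹ • symVecMulVec b)]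
    simp_rw [diagDensity_consSym_shear]
    rw [lintegral_const_mul _ ((measurable_diagDensity _ _).const_mul _),
      lintegral_const_mul _ (measurable_diagDensity _ _)]
    rfl
  have hb : ∀ a : ℝ, ∫⁻ b : Fin n → ℝ, ∏ i, ENNReal.ofReal (Real.exp (-(l i.succ / a) * b i ^ 2)) =
      ∏ i : Fin n, gaussLIntegral (l i.succ / a) := fun a =>
    lintegral_fin_prod (fun i x => ENNReal.ofReal (Real.exp (-(l i.succ / a) * x ^ 2)))
      fun i => by fun_prop
  have hbm : ∀ a : ℝ, Measurable fun b : Fin n → ℝ =>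
      ∏ i, ENNReal.ofReal (Real.exp (-(l i.succ / a) * b i ^ 2)) := fun a => by fun_prop
  rw [diagLIntegral, lintegral_symVolume_succ _ (measurable_diagDensity l s)]
  simp_rw [hC]
  have ha : ∀ a : ℝ, ∫⁻ b : Fin n → ℝ,
      (Set.Ioi (0 : ℝ)).indicator (fun a => ENNReal.ofReal
          (Real.exp (-(l 0 * a)) * a ^ (s - ((n : ℝ) + 2) / 2))) a *
        ((∏ i, ENNReal.ofReal (Real.exp (-(l i.succ / a) * b i ^ 2))) *
          diagLIntegral n (fun i => l i.succ) (s - 1 / 2)) =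
      (Set.Ioi (0 : ℝ)).indicator (fun a => ENNReal.ofReal
          (Real.exp (-(l 0 * a)) * a ^ (s - 1))) a *
        ((∏ i : Fin n, gaussLIntegral (l i.succ)) *
          diagLIntegral n (fun i => l i.succ) (s - 1 / 2)) := fun a => by
    rw [lintegral_const_mul _ ((hbm a).mul_const _), lintegral_mul_const _ (hbm a), hb]
    by_cases ha : 0 < a
    · rw [Set.indicator_of_mem (by simpa using ha), Set.indicator_of_mem (by simpa using ha)]
      -- Each of the `n` Gaussians releases a factor `√a`; together they raise the exponent from `s
      -- - (n+2)/2` to `s - 1`.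
      simp_rw [gaussLIntegral_div _ ha]
      rw [Finset.prod_mul_distrib, Finset.prod_const, Finset.card_univ, Fintype.card_fin,
        ← ENNReal.ofReal_pow (Real.sqrt_nonneg a), mul_assoc, ← mul_assoc,
        ← ENNReal.ofReal_mul (by positivity)]
      congr 2
      rw [mul_assoc, Real.sqrt_eq_rpow, ← Real.rpow_natCast, ← Real.rpow_mul ha.le,
        ← Real.rpow_add ha]
      congr 2
      ring
    · rw [Set.indicator_of_notMem (by simpa using ha), Set.indicator_of_notMem (by simpa using ha),
        zero_mul, zero_mul]
  simp_rw [ha]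
  rw [lintegral_mul_const, lintegral_indicator measurableSet_Ioi]
  · rfl
  · exact (measurable_exp_mul_rpow _ _).ennreal_ofReal.indicator measurableSet_Ioi

theorem diagLIntegral_ne_zero (l : Fin n → ℝ) (s : ℝ) : diagLIntegral n l s ≠ 0 := by
  induction n generalizing s with
  | zero => simp [diagLIntegral_zero]
  | succ n ih =>
    rw [diagLIntegral_succ]
    exact mul_ne_zero (gammaLIntegral_ne_zero _ _) (mul_ne_zero
      (Finset.prod_ne_zero_iff.mpr fun i _ => gaussLIntegral_ne_zero _) (ih _ _))

/-- In `[0, ∞]` a product of nonzero factors is finite only if each factor is. The bound on `s`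
requires `1 ≤ n`, since in size `0` the integral is `1` for every `s`. -/
theorem pos_of_diagLIntegral_ne_top {l : Fin n → ℝ} {s : ℝ} (h : diagLIntegral n l s ≠ ∞) :
    (∀ i, 0 < l i) ∧ (1 ≤ n → ((n : ℝ) - 1) / 2 < s) := by
  induction n generalizing s with
  | zero => simp
  | succ n ih =>
    rw [diagLIntegral_succ] at h
    have hJ := gammaLIntegral_ne_zero (l 0) s
    have hI := diagLIntegral_ne_zero (fun i => l i.succ) (s - 1 / 2)
    have hG : ∏ i : Fin n, gaussLIntegral (l i.succ) ≠ 0 :=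
      Finset.prod_ne_zero_iff.mpr fun i _ => gaussLIntegral_ne_zero _
    have h1 := pos_of_gammaLIntegral_ne_top fun h0 =>
      h (by rw [h0, ENNReal.top_mul (mul_ne_zero hG hI)])
    have h2 := ih fun h0 => h (by rw [h0, ENNReal.mul_top hG, ENNReal.mul_top hJ])
    refine ⟨fun i => Fin.cases h1.1 h2.1 i, fun _ => ?_⟩
    -- In size one the bound is `s > 0`, from the Gamma factor; in larger sizes it is the inductive
    -- bound moved by `1/2`.
    rcases Nat.eq_zero_or_pos n with rfl | hn
    · simpa using h1.2
    · have := h2.2 hn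
      push_cast
      linarith

/-- The factor `k = 1` splits off, and the others are those of size `n` at `s - 1/2`; the exponent
of `π` grows by `n/2`, one `√π` per Gaussian. -/
theorem wishartGamma_succ (n : ℕ) (s : ℝ) :
    wishartGamma (n + 1) s =
      Real.Gamma s * (Real.pi ^ ((n : ℝ) / 2) * wishartGamma n (s - 1 / 2)) := by
  have h : ∀ m : ℕ, ∀ t : ℝ, ∏ k ∈ Finset.Icc 1 m, Real.Gamma (t - ((k : ℝ) - 1) / 2) =
      ∏ k ∈ Finset.range m, Real.Gamma (t - (k : ℝ) / 2) := fun m t => by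
    rw [← Finset.Ico_succ_right_eq_Icc, Finset.prod_Ico_eq_prod_range]
    refine Finset.prod_congr (by simp) fun k _ => ?_
    push_cast
    congr 2
    ring
  rw [wishartGamma, wishartGamma, h, h, Finset.prod_range_succ']
  have h2 : (((n + 1 : ℕ) : ℝ) * (((n + 1 : ℕ) : ℝ) - 1) / 4) =
      (n : ℝ) / 2 + n * ((n : ℝ) - 1) / 4 := by push_cast; ring
  have h3 : ∏ k ∈ Finset.range n, Real.Gamma (s - ((k + 1 : ℕ) : ℝ) / 2) =
      ∏ k ∈ Finset.range n, Real.Gamma (s - 1 / 2 - (k : ℝ) / 2) :=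
    Finset.prod_congr rfl fun k _ => by
      push_cast
      congr 1
      ring
  rw [h2, h3, Real.rpow_add Real.pi_pos, Nat.cast_zero, zero_div, sub_zero]
  ring

theorem wishartGamma_pos {s : ℝ} (hs : ((n : ℝ) - 1) / 2 < s) : 0 < wishartGamma n s := by
  refine mul_pos (Real.rpow_pos_of_pos Real.pi_pos _) (Finset.prod_pos fun k hk => ?_)
  refine Real.Gamma_pos_of_pos ?_
  have : (k : ℝ) ≤ n := by exact_mod_cast (Finset.mem_Icc.mp hk).2
  linarith

theorem diagLIntegral_eq {l : Fin n → ℝ} (hl : ∀ i, 0 < l i) {s : ℝ}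
    (hs : ((n : ℝ) - 1) / 2 < s) :
    diagLIntegral n l s = ENNReal.ofReal (wishartGamma n s * (∏ i, l i) ^ (-s)) := by
  induction n generalizing s with
  | zero => simp [diagLIntegral_zero, wishartGamma]
  | succ n ih =>
    push_cast at hs
    have hs0 : 0 < s := by
      have : (0 : ℝ) ≤ n := n.cast_nonneg
      linarith
    have hp : 0 < ∏ i : Fin n, l i.succ := Finset.prod_pos fun i _ => hl i.succ
    have hs' : ((n : ℝ) - 1) / 2 < s - 1 / 2 := by linarith
    rw [diagLIntegral_succ, gammaLIntegral_eq (hl 0) hs0, ih (fun i => hl i.succ) hs',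
      Finset.prod_congr rfl fun i _ => gaussLIntegral_eq (hl (Fin.succ i)),
      ← ENNReal.ofReal_prod_of_nonneg fun i _ => Real.sqrt_nonneg _,
      ← ENNReal.ofReal_mul (Finset.prod_nonneg fun i _ => Real.sqrt_nonneg _),
      ← ENNReal.ofReal_mul (mul_nonneg (Real.Gamma_pos_of_pos hs0).le
        (Real.rpow_nonneg (hl 0).le _))]
    have hG : ∏ i : Fin n, √(Real.pi / l i.succ) =
        Real.pi ^ ((n : ℝ) / 2) * (∏ i : Fin n, l i.succ) ^ (-(1 / 2) : ℝ) := by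
      simp_rw [Real.sqrt_div Real.pi_pos.le]
      rw [Finset.prod_div_distrib, Finset.prod_const, Finset.card_univ, Fintype.card_fin,
        Real.sqrt_eq_rpow, ← Real.rpow_natCast, ← Real.rpow_mul Real.pi_pos.le,
        Real.rpow_neg hp.le, ← Real.finsetProd_rpow _ _ fun i _ => (hl i.succ).le, div_eq_mul_inv]
      simp_rw [Real.sqrt_eq_rpow]
      congr 2
      ring
    have he : (-s : ℝ) = -(1 / 2) + -(s - 1 / 2) := by ring
    rw [hG, wishartGamma_succ, Fin.prod_univ_succ, Real.mul_rpow (hl 0).le hp.le]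
    have hps : (∏ i : Fin n, l i.succ) ^ (-s) = (∏ i : Fin n, l i.succ) ^ (-(1 / 2) : ℝ) *
        (∏ i : Fin n, l i.succ) ^ (-(s - 1 / 2)) := by rw [← Real.rpow_add hp, ← he]
    rw [hps]
    congr 1
    ring

end Recursion

/-! ### The Wishart integral for a general symmetric parameter -/

section WishartIntegral

variable {n : ℕ}

/-- The density `exp(-Tr(y x)) (det x)^s`. -/
def wishartDensity (n : ℕ) (y : SymMat n) (s : ℝ) (x : SymPos n) : ℝ≥0∞ :=
  ENNReal.ofReal (Real.exp (-(y.1 * x.1.1).trace) * x.1.1.det ^ s)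

theorem measurable_wishartDensity (y : SymMat n) (s : ℝ) : Measurable (wishartDensity n y s) := by
  have h : Continuous fun x : SymPos n => (y.1 * x.1.1).trace :=
    (continuous_const.matrix_mul
      (continuous_subtype_val.comp continuous_subtype_val)).matrix_trace
  exact ((Real.continuous_exp.comp h.neg).mul (continuous_det_rpow n s)).measurable.ennreal_ofReal

/-- The integral of `exp(-Tr(y x)) (det x)^s` against the invariant measure. -/
def wishartLIntegral (n : ℕ) (y : SymMat n) (s : ℝ) : ℝ≥0∞ :=
  ∫⁻ x, wishartDensity n y s x ∂(posInvariant n)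

theorem wishartDensity_mul_det_rpow (y : SymMat n) (r s : ℝ) (x : SymPos n) :
    ENNReal.ofReal (x.1.1.det ^ r) * wishartDensity n y s x = wishartDensity n y (s + r) x := by
  rw [wishartDensity, wishartDensity, ← ENNReal.ofReal_mul (Real.rpow_nonneg (det_pos x).le _),
    Real.rpow_add (det_pos x)]
  congr 1
  ring

theorem lintegral_posInvariant {F : SymPos n → ℝ≥0∞} (hF : Measurable F) :
    ∫⁻ x, F x ∂(posInvariant n) =
      ∫⁻ x, ENNReal.ofReal (x.1.1.det ^ (-(((n : ℝ) + 1) / 2))) * F x ∂(posVolume n) :=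
  lintegral_withDensity_eq_lintegral_mul _ (continuous_det_rpow n _).measurable.ennreal_ofReal hF

theorem trace_diagonal_mul (d : Fin n → ℝ) (S : Matrix (Fin n) (Fin n) ℝ) :
    (Matrix.diagonal d * S).trace = ∑ i, d i * S i i := by
  simp [Matrix.trace, Matrix.diagonal_mul]

theorem wishartLIntegral_diagonal (d : Fin n → ℝ) (s : ℝ) :
    wishartLIntegral n ⟨Matrix.diagonal d, Matrix.diagonal_transpose d⟩ s =
      diagLIntegral n d s := by
  rw [wishartLIntegral, lintegral_posInvariant (measurable_wishartDensity _ _)]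
  simp_rw [wishartDensity_mul_det_rpow]
  rw [diagLIntegral, diagDensity, lintegral_indicator (isOpen_posDef n).measurableSet,
    ← lintegral_subtype_comap (isOpen_posDef n).measurableSet]
  refine lintegral_congr fun x => ?_
  rw [wishartDensity]
  simp only [trace_diagonal_mul]
  rfl

theorem lintegral_smul_posInvariant (hn : 1 ≤ n) (g : GL (Fin n) ℝ) {F : SymPos n → ℝ≥0∞}
    (hF : Measurable F) : ∫⁻ x, F (g • x) ∂(posInvariant n) = ∫⁻ x, F x ∂(posInvariant n) := by
  conv_rhs => rw [← map_smul_posInvariant hn g]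
  rw [lintegral_map hF (measurable_const_smul g)]

/-- Substituting `u x uᵗ` with `u` orthogonal preserves the measure and the determinant, and
cyclicity of the trace replaces `y` by `d`. No sign of `d` enters, so the divergent cases are
covered too. -/
theorem wishartLIntegral_eq_diag (hn : 1 ≤ n) (y : SymMat n) (s : ℝ) {u : GL (Fin n) ℝ}
    (hu : u ∈ orthGroup n) {d : Fin n → ℝ} (hd : y.1 = u.1 * Matrix.diagonal d * u.1.transpose) :
    wishartLIntegral n y s = diagLIntegral n d s := by
  rw [← wishartLIntegral_diagonal, wishartLIntegral, wishartLIntegral,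
    ← lintegral_smul_posInvariant hn u (measurable_wishartDensity _ _)]
  refine lintegral_congr fun x => ?_
  have h1 : u.1 * u.1.transpose = 1 := mem_orthGroup.mp hu
  have h2 : u.1.transpose * u.1 = 1 := mul_eq_one_comm.mp h1
  have hdet : |u.1.det| ^ 2 = 1 := by
    have := congrArg Matrix.det h1
    rw [Matrix.det_mul, Matrix.det_transpose, Matrix.det_one] at this
    rw [sq_abs, sq, this]
  rw [wishartDensity, wishartDensity, det_smul_symPos, hdet, one_mul]
  congr 4
  rw [SymPos.coe_smul, congrRep_coe, hd, mul_assoc u.1, mul_assoc u.1, mul_assoc,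
    Matrix.trace_mul_comm]
  congr 1
  simp only [mul_assoc]
  rw [← mul_assoc u.1.transpose u.1, h2, one_mul, mul_one]

theorem det_orthogonal_conj {u : GL (Fin n) ℝ} (hu : u ∈ orthGroup n) (d : Fin n → ℝ) :
    (u.1 * Matrix.diagonal d * u.1.transpose).det = ∏ i, d i := by
  have h1 : u.1 * u.1.transpose = 1 := mem_orthGroup.mp hu
  rw [Matrix.det_mul_right_comm, h1, one_mul, Matrix.det_diagonal]

theorem posDef_conj_diagonal_iff (u : GL (Fin n) ℝ) (d : Fin n → ℝ) :
    (u.1 * Matrix.diagonal d * u.1.transpose).PosDef ↔ ∀ i, 0 < d i := by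
  rw [← Matrix.conjTranspose_eq_transpose_of_trivial, ← Matrix.star_eq_conjTranspose,
    Matrix.IsUnit.posDef_star_right_conjugate_iff u.isUnit, Matrix.posDef_diagonal_iff]

/-- The normalizing constant of the Wishart distribution. -/
theorem wishartLIntegral_eq (hn : 1 ≤ n) {y : SymMat n} (hy : y.1.PosDef) {s : ℝ}
    (hs : ((n : ℝ) - 1) / 2 < s) :
    wishartLIntegral n y s = ENNReal.ofReal (wishartGamma n s * y.1.det ^ (-s)) := by
  obtain ⟨u, hu, d, hd⟩ := symMat_exists_orthogonal_diagonal y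
  rw [hd, posDef_conj_diagonal_iff] at hy
  rw [wishartLIntegral_eq_diag hn y s hu hd, diagLIntegral_eq hy hs, hd, det_orthogonal_conj hu]

theorem wishartLIntegral_ne_top_iff (hn : 1 ≤ n) (y : SymMat n) (s : ℝ) :
    wishartLIntegral n y s ≠ ∞ ↔ y.1.PosDef ∧ ((n : ℝ) - 1) / 2 < s := by
  constructor
  · intro h
    obtain ⟨u, hu, d, hd⟩ := symMat_exists_orthogonal_diagonal y
    rw [wishartLIntegral_eq_diag hn y s hu hd] at h
    obtain ⟨h1, h2⟩ := pos_of_diagLIntegral_ne_top h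
    exact ⟨by rwa [hd, posDef_conj_diagonal_iff], h2 hn⟩
  · rintro ⟨hy, hs⟩
    rw [wishartLIntegral_eq hn hy hs]
    exact ENNReal.ofReal_ne_top

theorem wishart_eq_smul (hn : 1 ≤ n) (y : SymPos n) {s : ℝ} (hs : ((n : ℝ) - 1) / 2 < s) :
    wishart n y s =
      (wishartLIntegral n y.1 s)⁻¹ • (posInvariant n).withDensity (wishartDensity n y.1 s) := by
  have hG := wishartGamma_pos hs
  have hy := Real.rpow_pos_of_pos (det_pos y) s
  have hinv : (wishartLIntegral n y.1 s)⁻¹ =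
      ENNReal.ofReal (y.1.1.det ^ s / wishartGamma n s) := by
    rw [wishartLIntegral_eq hn y.2 hs, Real.rpow_neg (det_pos y).le,
      ← ENNReal.ofReal_inv_of_pos (by positivity)]
    congr 1
    field_simp
  have hdet := (continuous_det_rpow n (-(((n : ℝ) + 1) / 2))).measurable.ennreal_ofReal
  rw [posInvariant, ← withDensity_mul _ hdet (measurable_wishartDensity _ _), hinv,
    ← withDensity_smul _ (hdet.mul (measurable_wishartDensity _ _)), wishart]
  congr 1
  ext1 x
  simp only [Pi.smul_apply, Pi.mul_apply, smul_eq_mul]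
  rw [wishartDensity_mul_det_rpow, wishartDensity, ← ENNReal.ofReal_mul (by positivity),
    ← mul_assoc, sub_eq_add_neg]

theorem isProbabilityMeasure_wishart (hn : 1 ≤ n) (y : SymPos n) {s : ℝ}
    (hs : ((n : ℝ) - 1) / 2 < s) : IsProbabilityMeasure (wishart n y s) where
  measure_univ := by
    have htop := (wishartLIntegral_ne_top_iff hn y.1 s).mpr ⟨y.2, hs⟩
    have h0 : wishartLIntegral n y.1 s ≠ 0 := by
      rw [wishartLIntegral_eq hn y.2 hs]
      simpa using mul_pos (wishartGamma_pos hs) (Real.rpow_pos_of_pos (det_pos y) (-s))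
    rw [wishart_eq_smul hn y hs, Measure.smul_apply, withDensity_apply _ MeasurableSet.univ,
      Measure.restrict_univ]
    exact ENNReal.inv_mul_cancel h0 htop

end WishartIntegral

/-! ### Transport of the construction to the cone -/

section Quotient

variable {n : ℕ}

theorem map_withDensity_comp {α β : Type*} [MeasurableSpace α] [MeasurableSpace β] {e : α → β}
    (he : Measurable e) {f : β → ℝ≥0∞} (hf : Measurable f) (μ : Measure α) :
    Measure.map e (μ.withDensity fun x => f (e x)) = (Measure.map e μ).withDensity f := by
  ext s hs
  rw [Measure.map_apply he hs, withDensity_apply _ (he hs), withDensity_apply _ hs,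
    setLIntegral_map hs hf he]

/-- The factor `2` comes from `det (g gᵗ) = |det g|²`. -/
theorem charFun_detChar (t : ℝ) (x : (wishartInput n).X) :
    (wishartInput n).charFun (detChar n (2 * t)) x = (toSymPos n x).1.1.det ^ t := by
  obtain ⟨g, rfl⟩ := Quotient.exists_rep x
  change |g.1.det| ^ (2 * t) = _
  rw [toSymPos_mk, det_smul_symPos]
  have : (posOne n).1.1.det = 1 := Matrix.det_one
  rw [this, mul_one, ← Real.rpow_natCast, ← Real.rpow_mul (abs_nonneg _)]
  norm_num

theorem measurable_toSymPos (n : ℕ) : Measurable (toSymPos n) :=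
  (isHomeomorph_toSymPos n).continuous.measurable

theorem map_unnormalized (μ : Measure (wishartInput n).X) (y : SymMat n) (s : ℝ) :
    Measure.map (toSymPos n)
        ((wishartInput n).unnormalized μ (traceDual n y, detChar n (2 * s))) =
      (Measure.map (toSymPos n) μ).withDensity (wishartDensity n y s) := by
  have h : ∀ x, ENNReal.ofReal (Real.exp (-(traceDual n y ((wishartInput n).orbit x))) *
      (wishartInput n).charFun (detChar n (2 * s)) x) = wishartDensity n y s (toSymPos n x) :=
    fun x => by rw [charFun_detChar]; rfl
  rw [← map_withDensity_comp (measurable_toSymPos n) (measurable_wishartDensity y s),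
    MethodInput.unnormalized]
  exact congrArg (fun f => Measure.map (toSymPos n) (μ.withDensity f)) (funext h)

theorem map_normalized (μ : Measure (wishartInput n).X)
    (θ : Module.Dual ℝ (SymMat n) × Omega0 (GL (Fin n) ℝ) (wishartInput n).H) :
    Measure.map (toSymPos n) ((wishartInput n).normalized μ θ) =
      (Measure.map (toSymPos n) ((wishartInput n).unnormalized μ θ) Set.univ)⁻¹ •
        Measure.map (toSymPos n) ((wishartInput n).unnormalized μ θ) := by
  rw [MethodInput.normalized, Measure.map_smul,
    Measure.map_apply (measurable_toSymPos n) MeasurableSet.univ, Set.preimage_univ]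

theorem mem_Theta_iff (μ : Measure (wishartInput n).X)
    (θ : Module.Dual ℝ (SymMat n) × Omega0 (GL (Fin n) ℝ) (wishartInput n).H) :
    θ ∈ (wishartInput n).Theta μ ↔
      Measure.map (toSymPos n) ((wishartInput n).unnormalized μ θ) Set.univ ≠ ∞ := by
  rw [Measure.map_apply (measurable_toSymPos n) MeasurableSet.univ, Set.preimage_univ]
  change (wishartInput n).unnormalized μ θ Set.univ < ∞ ↔ _
  exact lt_top_iff_ne_top

theorem withDensity_det_rpow (y : SymMat n) (r s : ℝ) (k : ℝ≥0∞) :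
    (k • (posInvariant n).withDensity fun x => ENNReal.ofReal (x.1.1.det ^ r)).withDensity
        (wishartDensity n y s) =
      k • (posInvariant n).withDensity (wishartDensity n y (s + r)) := by
  rw [withDensity_smul_measure, ← withDensity_mul _
    (continuous_det_rpow n r).measurable.ennreal_ofReal (measurable_wishartDensity y s)]
  congr 2
  ext1 x
  exact wishartDensity_mul_det_rpow y r s x

/-! ### The family of a measure proportional to a power of `det` times the invariant one -/

section PowerMeasure

variable {μ : Measure (wishartInput n).X} {k : ℝ≥0∞} {r : ℝ}

theorem map_unnormalized_univ
    (hμ : Measure.map (toSymPos n) μ =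
      k • (posInvariant n).withDensity fun x => ENNReal.ofReal (x.1.1.det ^ r))
    (y : SymMat n) (s : ℝ) :
    Measure.map (toSymPos n)
        ((wishartInput n).unnormalized μ (traceDual n y, detChar n (2 * s))) Set.univ =
      k * wishartLIntegral n y (s + r) := by
  rw [map_unnormalized, hμ, withDensity_det_rpow, Measure.smul_apply,
    withDensity_apply _ MeasurableSet.univ, Measure.restrict_univ]
  rfl

theorem mem_Theta_traceDual_iff (hn : 1 ≤ n) (hk : k ≠ 0) (hk' : k ≠ ∞)
    (hμ : Measure.map (toSymPos n) μ =
      k • (posInvariant n).withDensity fun x => ENNReal.ofReal (x.1.1.det ^ r))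
    (y : SymMat n) (s : ℝ) :
    (traceDual n y, detChar n (2 * s)) ∈ (wishartInput n).Theta μ ↔
      y.1.PosDef ∧ ((n : ℝ) - 1) / 2 < s + r := by
  rw [mem_Theta_iff, map_unnormalized_univ hμ, ← wishartLIntegral_ne_top_iff hn]
  refine not_congr ⟨fun h => ?_, fun h => by rw [h, ENNReal.mul_top hk]⟩
  rcases ENNReal.mul_eq_top.mp h with h | h
  · exact h.2
  · exact absurd h.1 hk'

theorem map_normalized_traceDual (hn : 1 ≤ n) (hk : k ≠ 0) (hk' : k ≠ ∞)
    (hμ : Measure.map (toSymPos n) μ =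
      k • (posInvariant n).withDensity fun x => ENNReal.ofReal (x.1.1.det ^ r))
    (y : SymPos n) (s : ℝ) (hs : ((n : ℝ) - 1) / 2 < s + r) :
    Measure.map (toSymPos n)
        ((wishartInput n).normalized μ (traceDual n y.1, detChar n (2 * s))) =
      wishart n y (s + r) := by
  rw [map_normalized, map_unnormalized_univ hμ, map_unnormalized, hμ, withDensity_det_rpow,
    smul_smul, wishart_eq_smul hn y hs, ENNReal.mul_inv (Or.inl hk) (Or.inl hk'),
    mul_right_comm, ENNReal.inv_mul_cancel hk hk', one_mul]

theorem map_family_eq (hn : 1 ≤ n) (hk : k ≠ 0) (hk' : k ≠ ∞)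
    (hμ : Measure.map (toSymPos n) μ =
      k • (posInvariant n).withDensity fun x => ENNReal.ofReal (x.1.1.det ^ r)) :
    Measure.map (toSymPos n) '' (wishartInput n).family μ =
      {p | ∃ (y : SymPos n) (s : ℝ), ((n : ℝ) - 1) / 2 < s ∧ p = wishart n y s} := by
  ext p
  constructor
  · rintro ⟨_, ⟨⟨φ, χ⟩, hθ, rfl⟩, rfl⟩
    obtain ⟨y, rfl⟩ := (bijective_traceDual n).2 φ
    obtain ⟨t, rfl⟩ := (bijective_detChar hn).2 χ
    -- Every character is `det^s` on the cone; the corresponding Wishart parameter is `s + r`.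
    obtain ⟨s, rfl⟩ : ∃ s, t = 2 * s := ⟨t / 2, by ring⟩
    obtain ⟨hy, hs⟩ := (mem_Theta_traceDual_iff hn hk hk' hμ y s).mp hθ
    exact ⟨⟨y, hy⟩, s + r, hs, map_normalized_traceDual hn hk hk' hμ ⟨y, hy⟩ s hs⟩
  · rintro ⟨y, s, hs, rfl⟩
    have hs' : ((n : ℝ) - 1) / 2 < s - r + r := by rwa [sub_add_cancel]
    refine ⟨_, ⟨(traceDual n y.1, detChar n (2 * (s - r))),
      (mem_Theta_traceDual_iff hn hk hk' hμ y.1 _).mpr ⟨y.2, hs'⟩, rfl⟩, ?_⟩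
    rw [map_normalized_traceDual hn hk hk' hμ y _ hs', sub_add_cancel]

end PowerMeasure

end Quotient

/-! ### Classification of the relatively invariant measures -/

section Invariance

variable {n : ℕ}

theorem measurableEmbedding_toSymPos (n : ℕ) : MeasurableEmbedding (toSymPos n) :=
  (isHomeomorph_toSymPos n).homeomorph.measurableEmbedding

theorem map_quotInvariant (n : ℕ) : Measure.map (toSymPos n) (quotInvariant n) = posInvariant n := by
  rw [quotInvariant, (measurableEmbedding_toSymPos n).map_comap,
    (isHomeomorph_toSymPos n).surjective.range_eq, Measure.restrict_univ]

theorem regular_quotInvariant (n : ℕ) : (quotInvariant n).Regular := by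
  let e := (isHomeomorph_toSymPos n).homeomorph
  have h : quotInvariant n = Measure.map e.symm (posInvariant n) :=
    MeasurableEquiv.comap_symm (μ := posInvariant n) e.toMeasurableEquiv.symm
  have : SigmaCompactSpace (SymPos n) := inferInstance
  have : (posInvariant n).Regular := inferInstance
  rw [h]
  exact Measure.Regular.map e.symm

theorem isRelInvariantWith_quotInvariant (hn : 1 ≤ n) :
    (wishartInput n).IsRelInvariantWith (quotInvariant n) fun _ => 1 where
  regular := regular_quotInvariant n
  ne_zero h := posInvariant_ne_zero n (by rw [← map_quotInvariant, h, Measure.map_zero])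
  pos _ := one_pos
  smul g E hE := by
    have himage : toSymPos n '' ((fun x => g • x) '' E) = (g⁻¹ • ·) ⁻¹' (toSymPos n '' E) := by
      ext S
      simp only [Set.mem_image, Set.mem_preimage, exists_exists_and_eq_and, toSymPos_smul]
      exact exists_congr fun x => and_congr_right fun _ => eq_inv_smul_iff.symm
    rw [ENNReal.ofReal_one, one_mul, quotInvariant,
      (measurableEmbedding_toSymPos n).comap_apply, (measurableEmbedding_toSymPos n).comap_apply,
      himage, ← Measure.map_apply (measurable_const_smul g⁻¹)
        ((measurableEmbedding_toSymPos n).measurableSet_image.mpr hE),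
      map_smul_posInvariant hn]

/-- The preimage under `g` is the image under `g⁻¹`, hence the inverse in the multiplier. -/
theorem map_smul_of_isRelInvariantWith {μ : Measure (wishartInput n).X} {f : GL (Fin n) ℝ → ℝ}
    (h : (wishartInput n).IsRelInvariantWith μ f) (g : GL (Fin n) ℝ) :
    Measure.map (g • ·) (Measure.map (toSymPos n) μ) =
      ENNReal.ofReal (f g⁻¹) • Measure.map (toSymPos n) μ := by
  have hT := measurable_toSymPos n
  have hg : Measurable fun S : SymPos n => g • S := measurable_const_smul g
  ext E hE
  have hset : toSymPos n ⁻¹' ((g • ·) ⁻¹' E) = (fun x => g⁻¹ • x) '' (toSymPos n ⁻¹' E) := by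
    ext x
    simp only [Set.mem_preimage, Set.mem_image]
    constructor
    · intro hx
      exact ⟨g • x, by rwa [toSymPos_smul], inv_smul_smul g x⟩
    · rintro ⟨z, hz, rfl⟩
      rwa [toSymPos_smul, smul_inv_smul]
  rw [Measure.map_apply hg hE, Measure.map_apply hT (hg hE), hset, h.smul _ _ (hT hE),
    Measure.smul_apply, Measure.map_apply hT hE, smul_eq_mul]

/-- The multiplier of a relatively invariant measure on `Sym⁺(n, ℝ)` is a power of `|det|`. -/
theorem exists_multiplier_eq_abs_det_rpow (hn : 1 ≤ n) {ρ : Measure (SymPos n)} [SigmaFinite ρ]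
    (h0 : ρ ≠ 0) {c : GL (Fin n) ℝ → ℝ} (hc : ∀ g, 0 < c g)
    (hρ : ∀ g : GL (Fin n) ℝ, Measure.map (g • ·) ρ = ENNReal.ofReal (c g) • ρ) :
    ∃ t : ℝ, ∀ g : GL (Fin n) ℝ, c g = |g.1.det| ^ t := by
  obtain ⟨E, hE, hE0, hEt⟩ : ∃ E, MeasurableSet E ∧ ρ E ≠ 0 ∧ ρ E ≠ ∞ := by
    by_contra! hcon
    refine h0 (Measure.measure_univ_eq_zero.mp ?_)
    rw [← iUnion_spanningSets ρ]
    exact measure_iUnion_null fun i => by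
      by_contra hi
      exact (measure_spanningSets_lt_top ρ i).ne (hcon _ (measurableSet_spanningSets ρ i) hi)
  -- No continuity of the multiplier is assumed: as a ratio of measures of translates of one set it
  -- is measurable by Fubini, which is enough for the character lemma.
  have hval : ∀ g : GL (Fin n) ℝ, c g = (ρ ((g • ·) ⁻¹' E)).toReal / (ρ E).toReal := fun g => by
    rw [← Measure.map_apply (measurable_const_smul g) hE, hρ, Measure.smul_apply, smul_eq_mul,
      ENNReal.toReal_mul, ENNReal.toReal_ofReal (hc g).le, mul_div_assoc,
      div_self (ENNReal.toReal_ne_zero.mpr ⟨hE0, hEt⟩), mul_one]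
  have hcancel : ∀ a b : ℝ, 0 < a → 0 < b →
      ENNReal.ofReal a • ρ = ENNReal.ofReal b • ρ → a = b := fun a b ha hb hab => by
    have h1 := congrArg (fun m : Measure (SymPos n) => (m E).toReal) hab
    simp only [Measure.smul_apply, smul_eq_mul, ENNReal.toReal_mul, ENNReal.toReal_ofReal ha.le,
      ENNReal.toReal_ofReal hb.le] at h1
    exact mul_right_cancel₀ (ENNReal.toReal_ne_zero.mpr ⟨hE0, hEt⟩) h1
  let χ : GL (Fin n) ℝ →* ℝ :=
    { toFun := c
      map_one' := hcancel _ _ (hc 1) one_pos (by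
        rw [← hρ]
        simp only [one_smul, ENNReal.ofReal_one]
        exact Measure.map_id)
      map_mul' := fun g k => hcancel _ _ (hc _) (mul_pos (hc g) (hc k)) (by
        rw [ENNReal.ofReal_mul (hc g).le, mul_comm, ← smul_smul, ← hρ g, ← Measure.map_smul,
          ← hρ k, Measure.map_map (measurable_const_smul g) (measurable_const_smul k), ← hρ]
        simp only [mul_smul]
        rfl) }
  have hmeas : Measurable c := by
    rw [funext hval]
    have hs : MeasurableSet {p : GL (Fin n) ℝ × SymPos n | p.1 • p.2 ∈ E} := measurable_smul hE
    exact (measurable_measure_prodMk_left hs).ennreal_toReal.div_const _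
  exact exists_eq_abs_det_rpow hn χ hc hmeas

/-- This provides a comparison measure for each possible multiplier; the exponent is halved because
`det` scales by `|det g|²`. -/
theorem map_smul_withDensity_det_rpow (hn : 1 ≤ n) (t : ℝ) (g : GL (Fin n) ℝ) :
    Measure.map (g • ·)
        ((posInvariant n).withDensity fun x => ENNReal.ofReal (x.1.1.det ^ (-(t / 2)))) =
      ENNReal.ofReal (|g.1.det| ^ t) •
        (posInvariant n).withDensity fun x => ENNReal.ofReal (x.1.1.det ^ (-(t / 2))) := by
  have hg : 0 < |g.1.det| := abs_pos.mpr (det_ne_zero g)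
  have hm : Measurable fun S : SymPos n => g • S := measurable_const_smul g
  have hd := (continuous_det_rpow n (-(t / 2))).measurable.ennreal_ofReal
  have h1 : ∀ x : SymPos n, ENNReal.ofReal (x.1.1.det ^ (-(t / 2))) =
      (ENNReal.ofReal (|g.1.det| ^ t) •
        fun x : SymPos n => ENNReal.ofReal (x.1.1.det ^ (-(t / 2)))) (g • x) := fun x => by
    rw [Pi.smul_apply, smul_eq_mul, ← ENNReal.ofReal_mul (by positivity), det_smul_symPos,
      Real.mul_rpow (by positivity) (det_pos x).le, ← mul_assoc, ← Real.rpow_natCast,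
      ← Real.rpow_mul hg.le, ← Real.rpow_add hg]
    have h2 : t + ((2 : ℕ) : ℝ) * -(t / 2) = 0 := by push_cast; ring
    rw [h2, Real.rpow_zero, one_mul]
  conv_lhs => rw [funext h1]
  rw [map_withDensity_comp hm (hd.const_smul _), map_smul_posInvariant hn, withDensity_smul _ hd]

/-- A relatively invariant measure on `GL(n, ℝ) / O(n)` is a multiple of a power of the
determinant times the invariant measure. -/
theorem exists_map_eq_withDensity_of_isRelInvariant (hn : 1 ≤ n)
    {μ : Measure (wishartInput n).X} (hμ : (wishartInput n).IsRelInvariant μ) :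
    ∃ (k : ℝ≥0∞) (r : ℝ), k ≠ 0 ∧ k ≠ ∞ ∧ Measure.map (toSymPos n) μ =
      k • (posInvariant n).withDensity fun x => ENNReal.ofReal (x.1.1.det ^ r) := by
  obtain ⟨f, hf⟩ := hμ
  have hreg := hf.regular
  let ρ := Measure.map (toSymPos n) μ
  have : ρ.Regular := Measure.Regular.map (isHomeomorph_toSymPos n).homeomorph
  have hρ0 : ρ ≠ 0 := fun h => hf.ne_zero
    ((Measure.map_eq_zero_iff (measurable_toSymPos n).aemeasurable).mp h)
  obtain ⟨t, ht⟩ := exists_multiplier_eq_abs_det_rpow hn hρ0 (fun g => hf.pos g⁻¹)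
    (map_smul_of_isRelInvariantWith hf)
  have hd := continuous_det_rpow n (-(t / 2))
  have : IsLocallyFiniteMeasure
      ((posInvariant n).withDensity fun x => ENNReal.ofReal (x.1.1.det ^ (-(t / 2)))) :=
    IsLocallyFiniteMeasure.withDensity_ofReal hd
  have hne : ((posInvariant n).withDensity fun x => ENNReal.ofReal (x.1.1.det ^ (-(t / 2)))) ≠ 0 := by
    intro h
    rw [withDensity_eq_zero_iff hd.measurable.ennreal_ofReal.aemeasurable] at h
    have hbot : Filter.NeBot (ae (posInvariant n)) := ae_neBot.mpr (posInvariant_ne_zero n)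
    obtain ⟨x, hx⟩ := h.exists
    have := Real.rpow_pos_of_pos (det_pos x) (-(t / 2))
    simp only [Pi.zero_apply, ENNReal.ofReal_eq_zero] at hx
    linarith
  obtain ⟨k, hk, hk', h⟩ := exists_eq_smul_of_relInvariant (Measure.haar : Measure (GL (Fin n) ℝ))
    (NeZero.ne _) hρ0 hne (fun g => ENNReal.ofReal (|g.1.det| ^ t))
    (fun g => by rw [map_smul_of_isRelInvariantWith hf, ht])
    (map_smul_withDensity_det_rpow hn t)
  exact ⟨k, -(t / 2), hk, hk', h⟩

theorem map_quotInvariant_eq_smul_withDensity (n : ℕ) :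
    Measure.map (toSymPos n) (quotInvariant n) =
      (1 : ℝ≥0∞) • (posInvariant n).withDensity fun x => ENNReal.ofReal (x.1.1.det ^ (0 : ℝ)) := by
  simp only [Real.rpow_zero, ENNReal.ofReal_one, one_smul, map_quotInvariant]
  exact withDensity_one.symm

end Invariance

end

/-! ### Assembly of the claims -/

theorem mainTheorem4 (n : ℕ) (hn : 1 ≤ n) :
    -- `I_n` is fixed by `O(n)`
    (∀ h ∈ orthGroup n, congrRep n h (symOne n) = symOne n) ∧
    -- `g O(n) ↦ g gᵗ` identifies `GL(n, ℝ) / O(n)` with `Sym⁺(n, ℝ)`, equivariantly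
    IsHomeomorph (toSymPos n) ∧
    (∀ (g : GL (Fin n) ℝ) (x : (wishartInput n).X),
      (toSymPos n (g • x)).1 = congrRep n g (toSymPos n x).1) ∧
    -- `Ω₀ = {|det g|^t}`, with one character for each real `t`
    Function.Bijective (detChar n) ∧
    -- the dual of `Sym(n, ℝ)` is `Sym(n, ℝ)` through `Tr(y x)`
    Function.Bijective (traceDual n) ∧
    -- `dx / (det x)^((n+1)/2)` is a `GL(n, ℝ)`-invariant measure
    (wishartInput n).IsRelInvariantWith (quotInvariant n) (fun _ => 1) ∧
    -- the parameter space
    (∀ (y : SymMat n) (α : ℝ),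
      (traceDual n y, detChar n (2 * α)) ∈ (wishartInput n).Theta (quotInvariant n) ↔
        y.1.PosDef ∧ ((n : ℝ) - 1) / 2 < α) ∧
    -- the unnormalized measures and the normalizing constant
    (∀ (y : SymMat n) (α : ℝ),
      Measure.map (toSymPos n)
          ((wishartInput n).unnormalized (quotInvariant n) (traceDual n y, detChar n (2 * α))) =
        (posInvariant n).withDensity fun x =>
          ENNReal.ofReal (Real.exp (-(y.1 * x.1.1).trace) * x.1.1.det ^ α)) ∧
    (∀ (y : SymPos n) (α : ℝ), ((n : ℝ) - 1) / 2 < α →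
      ∫⁻ x : SymPos n, ENNReal.ofReal (Real.exp (-(y.1.1 * x.1.1).trace) * x.1.1.det ^ α)
          ∂(posInvariant n) =
        ENNReal.ofReal (wishartGamma n α * y.1.1.det ^ (-α))) ∧
    -- the distribution attached to each parameter
    (∀ (y : SymPos n) (α : ℝ), ((n : ℝ) - 1) / 2 < α →
      IsProbabilityMeasure (wishart n y α) ∧
      Measure.map (toSymPos n)
          ((wishartInput n).normalized (quotInvariant n)
            (traceDual n y.1, detChar n (2 * α))) = wishart n y α) ∧
    -- the family does not depend on the relatively invariant measure and is the Wishart family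
    (∀ μ : Measure (wishartInput n).X, (wishartInput n).IsRelInvariant μ →
      Measure.map (toSymPos n) '' (wishartInput n).family μ =
        {p | ∃ (y : SymPos n) (α : ℝ), ((n : ℝ) - 1) / 2 < α ∧ p = wishart n y α}) := by
  refine ⟨congrRep_symOne n, isHomeomorph_toSymPos n,
    fun g x => congrArg Subtype.val (toSymPos_smul n g x), bijective_detChar hn,
    bijective_traceDual n, isRelInvariantWith_quotInvariant hn, fun y α => ?_, fun y α => ?_,
    fun y α hα => wishartLIntegral_eq hn y.2 hα,
    fun y α hα => ⟨isProbabilityMeasure_wishart hn y hα, ?_⟩, fun μ hμ => ?_⟩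
  · simpa using mem_Theta_traceDual_iff hn one_ne_zero ENNReal.one_ne_top
      (map_quotInvariant_eq_smul_withDensity n) y α
  · rw [map_unnormalized, map_quotInvariant]
    rfl
  · simpa using map_normalized_traceDual hn one_ne_zero ENNReal.one_ne_top
      (map_quotInvariant_eq_smul_withDensity n) y α (by simpa using hα)
  · obtain ⟨k, r, hk, hk', h⟩ := exists_map_eq_withDensity_of_isRelInvariant hn hμ
    exact map_family_eq hn hk hk' h
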